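/- Let $Q$ be a divisible unital quantale: a complete lattice with an associative unital multiplication $\&$ that preserves arbitrary joins in each variable, such that $x\le y$ implies $y\,\&\,a=x=b\,\&\,y$ for some $a,b\in Q$. Write $x\,\&\,y\le z\iff x\le z/y\iff y\le x\backslash z$. A *quantaloid* is a category whose hom-sets are complete lattices and whose composition preserves arbitrary joins in each variable. Let $\mathsf D Q$ be the quantaloid with object set $Q$, hom-sets $\mathsf DQ(x,y)=\{u\in Q: u\le x\wedge y\}$ (ordered as in $Q$), composition $v\circ u=v\,\&\,(y\backslash u)=(v/y)\,\&\,u$ for $u\in\mathsf DQ(x,y)$, $v\in\mathsf DQ(y,z)$, and identity $x$ on $x$. For $u\in\mathsf DQ(x,y)$ and $w\in\mathsf DQ(x,z)$ let $w\swarrow u\in\mathsf DQ(y,z)$ be the largest $v$ with $v\circ u\le w$. *Fuzzy closure spaces.* A fuzzy set is a set $X$ with a map $m_X:X\to Q$. A fuzzy relation $\zeta:X\to Y$ is a family $\zeta(x,y)\in\mathsf DQ(m_Xx,m_Yy)$; fuzzy relations are ordered pointwise and composed by $(\eta\circ\zeta)(x,z)=\bigvee_{y}\eta(y,z)\circ\zeta(x,y)$,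 and the identity on $X$ takes the value $m_Xx$ at $(x,x)$ and $\bot$ elsewhere. The fuzzy powerset $\mathsf PX$ consists of all pairs $(\mu,q)$ with $q\in Q$ and $\mu(x)\in\mathsf DQ(m_Xx,q)$ for $x\in X$ (of type $q$), with hom-arrows $\mathsf PX(\mu,\mu')=\bigwedge_{x}\mu'(x)\swarrow\mu(x)$ and, for each fixed type, the pointwise order. A fuzzy closure space $(X,c)$ is a fuzzy set $X$ with a type-preserving map $c:\mathsf PX\to\mathsf PX$ satisfying $\mathsf PX(\mu,\mu')\le\mathsf PX(c\mu,c\mu')$, $\mu\le c\mu$ and $cc\mu\le c\mu$. A fuzzy relation $\zeta:(X,c)\to(Y,d)$ is continuous if $(d\lambda)\circ\zeta\le c(\lambda\circ\zeta)$ for all $\lambda\in\mathsf PY$, where $(\lambda\circ\zeta)(x)=\bigvee_y\lambda(y)\circ\zeta(x,y)$; its closure $\operatorname{cl}\zeta$ is given by $(\operatorname{cl}\zeta)(-,y)=c(\zeta(-,y))$, and $\zeta$ is closed if $\operatorname{cl}\zeta=\zeta$. Fuzzy closure spaces and closed continuous fuzzy relations form a quantaloid $(\mathsf DQ\text{-}\mathbf{ClsRel})_{\mathrm{cl}}$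 with composites $\operatorname{cl}(\eta\circ\zeta)$, identities $\operatorname{cl}(\mathrm{id}_X)$ and joins $\operatorname{cl}(\bigvee_i\zeta_i)$. *Complete preordered fuzzy sets.* A preordered fuzzy set is a fuzzy set $X$ with a fuzzy relation $\alpha:X\to X$ such that $m_Xx\le\alpha(x,x)$ and $\alpha(y,z)\circ\alpha(x,y)\le\alpha(x,z)$. Put $x\le y$ if $m_Xx=m_Xy\le\alpha(x,y)$; $X$ is separated if this preorder is antisymmetric. A presheaf of type $q\in Q$ on $X$ is a family $\mu(x)\in\mathsf DQ(m_Xx,q)$ with $\mu(x)\circ\alpha(x',x)\le\mu(x')$; a supremum of it is an $s\in X$ with $m_Xs=q$ and $\alpha(s,x)=\bigwedge_y\alpha(y,x)\swarrow\mu(y)$ for all $x$; $X$ is complete if every presheaf has a supremum. A map $f:(X,\alpha)\to(Y,\beta)$ with $m_Y(fx)=m_Xx$ and $\alpha(x,x')\le\beta(fx,fx')$ is sup-preserving if $f(\sup\mu)$ is a supremum of the presheaf $y\mapsto\bigvee_x\mu(x)\circ\beta(y,fx)$ for every presheaf $\mu$ on $X$. Separated complete preordered fuzzy sets and sup-preserving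 maps, with the pointwise order on maps, form a quantaloid $\mathsf DQ\text{-}\mathbf{Sup}$. **Claim.** The quantaloids $(\mathsf DQ\text{-}\mathbf{ClsRel})_{\mathrm{cl}}$ and $\mathsf DQ\text{-}\mathbf{Sup}$ are dually equivalent: there is an equivalence of categories $(\mathsf DQ\text{-}\mathbf{ClsRel})_{\mathrm{cl}}^{\mathrm{op}}\simeq\mathsf DQ\text{-}\mathbf{Sup}$ whose functors in both directions preserve arbitrary joins of arrows. -/

import Mathlib

open CategoryTheory

universe u v w

namespace FuzzyClosure

/-! ### Quantaloids -/

/-- A quantaloid: a category whose hom-sets are complete lattices and whose composition preserves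
arbitrary joins in each variable. The composite written `v ∘ u` in the usual order is `u ≫ v`. -/
class Quantaloid (C : Type v) extends Category.{w} C where
  [homLattice : ∀ X Y : C, CompleteLattice (X ⟶ Y)]
  comp_sSup : ∀ {X Y Z : C} (f : X ⟶ Y) (S : Set (Y ⟶ Z)), f ≫ sSup S = ⨆ g ∈ S, f ≫ g
  sSup_comp : ∀ {X Y Z : C} (S : Set (X ⟶ Y)) (g : Y ⟶ Z), sSup S ≫ g = ⨆ f ∈ S, f ≫ g

attribute [reducible, instance] Quantaloid.homLattice

/-- Two quantaloids are dually equivalent: there is an equivalence of categories `Cᵒᵖ ≌ D` both of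
whose functors preserve arbitrary joins of arrows (the order on the hom-sets of the opposite
quantaloid being that of `C`). -/
def DuallyEquivalent (C : Type v) (D : Type v) [Quantaloid.{v, w} C] [Quantaloid.{v, w} D] : Prop :=
  ∃ e : Cᵒᵖ ≌ D,
    (∀ (X Y : C) (S : Set (X ⟶ Y)), e.functor.map (sSup S).op = ⨆ f ∈ S, e.functor.map f.op) ∧
    (∀ (A B : D) (S : Set (A ⟶ B)),
      (e.inverse.map (sSup S)).unop = ⨆ g ∈ S, (e.inverse.map g).unop)

section Basic

variable {C : Type v} [Quantaloid.{v, w} C]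

theorem comp_iSup {X Y Z : C} {ι : Sort*} (f : X ⟶ Y) (g : ι → (Y ⟶ Z)) :
    f ≫ (⨆ i, g i) = ⨆ i, f ≫ g i := by
  rw [iSup, Quantaloid.comp_sSup, iSup_range]

theorem iSup_comp {X Y Z : C} {ι : Sort*} (f : ι → (X ⟶ Y)) (g : Y ⟶ Z) :
    (⨆ i, f i) ≫ g = ⨆ i, f i ≫ g := by
  rw [iSup, Quantaloid.sSup_comp, iSup_range]

theorem comp_mono {X Y Z : C} {f f' : X ⟶ Y} {g g' : Y ⟶ Z} (hf : f ≤ f') (hg : g ≤ g') :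
    f ≫ g ≤ f' ≫ g' := by
  have h1 : f ≫ g ≤ f ≫ g' := by
    have := Quantaloid.comp_sSup f {g, g'}
    rw [sSup_pair, sup_eq_right.2 hg] at this
    rw [this]
    exact le_iSup₂_of_le g (by simp) le_rfl
  have h2 : f ≫ g' ≤ f' ≫ g' := by
    have := Quantaloid.sSup_comp {f, f'} g'
    rw [sSup_pair, sup_eq_right.2 hf] at this
    rw [this]
    exact le_iSup₂_of_le f (by simp) le_rfl
  exact h1.trans h2

/-- The left implication `w ↙ u : q ⟶ r` of `w : p ⟶ r` and `u : p ⟶ q`: the right adjoint of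
`v ↦ v ∘ u`. -/
def lda {p q r : C} (w : p ⟶ r) (u : p ⟶ q) : q ⟶ r := sSup {v | u ≫ v ≤ w}

theorem le_lda {p q r : C} {w : p ⟶ r} {u : p ⟶ q} {v : q ⟶ r} : v ≤ lda w u ↔ u ≫ v ≤ w := by
  constructor
  · intro h
    refine (comp_mono le_rfl h).trans ?_
    rw [lda, Quantaloid.comp_sSup]
    exact iSup₂_le fun v hv => hv
  · exact fun h => le_sSup h

end Basic

/-! ### Quotients of quantaloids by nuclei -/

/-- A nucleus on a quantaloid: a lax functor that is the identity on objects and a closure operator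
on each hom-set. -/
structure QuantaloidNucleus (C : Type v) [Quantaloid.{v, w} C] where
  cl (X Y : C) : ClosureOperator (X ⟶ Y)
  cl_comp_cl_le : ∀ {X Y Z : C} (f : X ⟶ Y) (g : Y ⟶ Z), cl X Y f ≫ cl Y Z g ≤ cl X Z (f ≫ g)

theorem QuantaloidNucleus.cl_cl_comp {C : Type v} [Quantaloid.{v, w} C] (j : QuantaloidNucleus C)
    {X Y Z : C} (f : X ⟶ Y) (g : Y ⟶ Z) : j.cl X Z (j.cl X Y f ≫ g) = j.cl X Z (f ≫ g) := by
  refine le_antisymm ?_ ((j.cl X Z).monotone (comp_mono ((j.cl X Y).le_closure f) le_rfl))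
  refine ((j.cl X Z).monotone ((comp_mono le_rfl ((j.cl Y Z).le_closure g)).trans
    (j.cl_comp_cl_le f g))).trans ?_
  rw [ClosureOperator.idempotent]

theorem QuantaloidNucleus.cl_comp_cl {C : Type v} [Quantaloid.{v, w} C] (j : QuantaloidNucleus C)
    {X Y Z : C} (f : X ⟶ Y) (g : Y ⟶ Z) : j.cl X Z (f ≫ j.cl Y Z g) = j.cl X Z (f ≫ g) := by
  refine le_antisymm ?_ ((j.cl X Z).monotone (comp_mono le_rfl ((j.cl Y Z).le_closure g)))
  refine ((j.cl X Z).monotone ((comp_mono ((j.cl X Y).le_closure f) le_rfl).trans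
    (j.cl_comp_cl_le f g))).trans ?_
  rw [ClosureOperator.idempotent]

/-- The quotient quantaloid of `C` by a nucleus `j`: the objects are those of `C` and the arrows are
the arrows of `C` fixed by `j`. -/
@[ext]
structure QuotientQuantaloid {C : Type v} [Quantaloid.{v, w} C] (j : QuantaloidNucleus C) where
  obj : C

/-- In the quotient, identities are `j (𝟙 X)`, composites are `j (f ≫ g)` and joins are
`j (⨆ i, f i)`. -/
instance {C : Type v} [Quantaloid.{v, w} C] (j : QuantaloidNucleus C) :
    Quantaloid.{v, w} (QuotientQuantaloid j) where
  Hom X Y := (j.cl X.obj Y.obj).Closeds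
  id X := (j.cl X.obj X.obj).toCloseds (𝟙 X.obj)
  comp {X _ Z} f g := (j.cl X.obj Z.obj).toCloseds (f.1 ≫ g.1)
  id_comp {X Y} f := by
    apply Subtype.ext
    change j.cl _ _ (j.cl _ _ (𝟙 X.obj) ≫ f.1) = f.1
    rw [j.cl_cl_comp, Category.id_comp]
    exact f.2.closure_eq
  comp_id {X Y} f := by
    apply Subtype.ext
    change j.cl _ _ (f.1 ≫ j.cl _ _ (𝟙 Y.obj)) = f.1
    rw [j.cl_comp_cl, Category.comp_id]
    exact f.2.closure_eq
  assoc f g h := by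
    apply Subtype.ext
    change j.cl _ _ (j.cl _ _ (f.1 ≫ g.1) ≫ h.1) = j.cl _ _ (f.1 ≫ j.cl _ _ (g.1 ≫ h.1))
    rw [j.cl_cl_comp, j.cl_comp_cl, Category.assoc]
  homLattice X Y := (j.cl X.obj Y.obj).gi.liftCompleteLattice
  comp_sSup {X Y Z} f S := by
    let _ := fun X Y : QuotientQuantaloid j => (j.cl X.obj Y.obj).gi.liftCompleteLattice
    refine le_antisymm ?_ (iSup₂_le fun g hg => ?_)
    · change j.cl _ _ (f.1 ≫ j.cl _ _ (sSup (Subtype.val '' S))) ≤ _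
      rw [j.cl_comp_cl, Quantaloid.comp_sSup]
      refine ClosureOperator.closure_min ?_ (Subtype.property _)
      refine iSup₂_le ?_
      rintro _ ⟨g, hg, rfl⟩
      exact ((j.cl _ _).le_closure _).trans
        (le_iSup₂_of_le (f := fun (g : (j.cl Y.obj Z.obj).Closeds) (_ : g ∈ S) =>
          (j.cl X.obj Z.obj).toCloseds (f.1 ≫ g.1)) g hg le_rfl)
    · exact (j.cl _ _).monotone (comp_mono le_rfl (Subtype.coe_le_coe.2 (le_sSup hg)))
  sSup_comp {X Y Z} S g := by
    let _ := fun X Y : QuotientQuantaloid j => (j.cl X.obj Y.obj).gi.liftCompleteLattice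
    refine le_antisymm ?_ (iSup₂_le fun f hf => ?_)
    · change j.cl _ _ (j.cl _ _ (sSup (Subtype.val '' S)) ≫ g.1) ≤ _
      rw [j.cl_cl_comp, Quantaloid.sSup_comp]
      refine ClosureOperator.closure_min ?_ (Subtype.property _)
      refine iSup₂_le ?_
      rintro _ ⟨f, hf, rfl⟩
      exact ((j.cl _ _).le_closure _).trans
        (le_iSup₂_of_le (f := fun (f : (j.cl X.obj Y.obj).Closeds) (_ : f ∈ S) =>
          (j.cl X.obj Z.obj).toCloseds (f.1 ≫ g.1)) f hf le_rfl)
    · exact (j.cl _ _).monotone (comp_mono (Subtype.coe_le_coe.2 (le_sSup hf)) le_rfl)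

/-! ### Typed sets, relations and closure spaces

Here `𝒬` is a small quantaloid. -/

/-- A set whose elements carry a type, an object of `𝒬`; it is regarded as a discrete category
enriched in `𝒬`. -/
structure TypedSet (𝒬 : Type u) where
  carrier : Type u
  type : carrier → 𝒬

instance (𝒬 : Type u) : CoeSort (TypedSet 𝒬) (Type u) := ⟨TypedSet.carrier⟩

section Closure

variable {𝒬 : Type u} [Quantaloid.{u, u} 𝒬]

/-- `𝒬`-relations between typed sets, ordered pointwise. -/
abbrev QRel (X Y : TypedSet 𝒬) : Type u := ∀ (x : X) (y : Y), X.type x ⟶ Y.type y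

open Classical in
/-- The identity relation. -/
noncomputable def QRel.id (X : TypedSet 𝒬) : QRel X X :=
  fun x y => if h : x = y then eqToHom (congrArg X.type h) else ⊥

/-- The composite `η ∘ ζ` of relations. -/
def QRel.comp {X Y Z : TypedSet 𝒬} (ζ : QRel X Y) (η : QRel Y Z) : QRel X Z :=
  fun x z => ⨆ y, ζ x y ≫ η y z

/-- The presheaves of type `q` on the discrete category `X`, that is, the relations from `X` to the
one-element typed set `{q}`, ordered pointwise. -/
abbrev PSh (X : TypedSet 𝒬) (q : 𝒬) : Type u := ∀ x : X, X.type x ⟶ q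

/-- The hom-arrow `PX(μ, μ') = μ' ↙ μ` of the category `PX` of presheaves. -/
def PSh.hom {X : TypedSet 𝒬} {q q' : 𝒬} (μ : PSh X q) (μ' : PSh X q') : q ⟶ q' :=
  ⨅ x, lda (μ' x) (μ x)

/-- The map `ζ^* : PY → PX`, `λ ↦ λ ∘ ζ`. -/
def QRel.pull {X Y : TypedSet 𝒬} (ζ : QRel X Y) {q : 𝒬} (l : PSh Y q) : PSh X q :=
  fun x => ⨆ y, ζ x y ≫ l y

variable (𝒬) in
/-- A closure space on a typed set `X`: a type-preserving map `c : PX → PX` that is a functor of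
`𝒬`-categories and satisfies `1 ≤ c` and `c ∘ c ≤ c`. -/
structure ClosureSpace extends TypedSet 𝒬 where
  cl : ∀ {q : 𝒬}, PSh toTypedSet q → PSh toTypedSet q
  hom_le : ∀ {q q' : 𝒬} (μ : PSh toTypedSet q) (μ' : PSh toTypedSet q'),
    μ.hom μ' ≤ (cl μ).hom (cl μ')
  le_cl : ∀ {q : 𝒬} (μ : PSh toTypedSet q), μ ≤ cl μ
  cl_cl_le : ∀ {q : 𝒬} (μ : PSh toTypedSet q), cl (cl μ) ≤ cl μ

/-- Continuity of a relation `ζ : (X, c) → (Y, d)` between closure spaces: `ζ^* d ≤ c ζ^*`. -/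
def QRel.IsContinuous {X Y : ClosureSpace 𝒬} (ζ : QRel X.toTypedSet Y.toTypedSet) : Prop :=
  ∀ (q : 𝒬) (l : PSh Y.toTypedSet q), ζ.pull (Y.cl l) ≤ X.cl (ζ.pull l)

/-- The closure of a relation `ζ : (X, c) → (Y, d)`: each presheaf `ζ(-, y)` on `X`, of type `|y|`,
is replaced by its closure. -/
def QRel.closure {X Y : ClosureSpace 𝒬} (ζ : QRel X.toTypedSet Y.toTypedSet) :
    QRel X.toTypedSet Y.toTypedSet :=
  fun x y => X.cl (fun x' => ζ x' y) x

theorem QRel.pull_id {X : TypedSet 𝒬} {q : 𝒬} (l : PSh X q) : (QRel.id X).pull l = l := by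
  funext x
  refine le_antisymm (iSup_le fun y => ?_) (le_iSup_of_le x ?_)
  · unfold QRel.id
    split_ifs with h
    · subst h; simp
    · have : (⊥ : X.type x ⟶ X.type y) ≫ l y = ⊥ := by
        rw [← sSup_empty, Quantaloid.sSup_comp]; simp
      rw [this]; exact bot_le
  · simp [QRel.id]

theorem QRel.comp_id {X Y : TypedSet 𝒬} (ζ : QRel X Y) : ζ.comp (QRel.id Y) = ζ := by
  funext x y
  refine le_antisymm (iSup_le fun y' => ?_) (le_iSup_of_le y ?_)
  · unfold QRel.id
    split_ifs with h
    · subst h; simp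
    · have : ζ x y' ≫ (⊥ : Y.type y' ⟶ Y.type y) = ⊥ := by
        rw [← sSup_empty, Quantaloid.comp_sSup]; simp
      rw [this]; exact bot_le
  · simp [QRel.id]

theorem QRel.pull_comp {X Y Z : TypedSet 𝒬} (ζ : QRel X Y) (η : QRel Y Z) {q : 𝒬} (l : PSh Z q) :
    (ζ.comp η).pull l = ζ.pull (η.pull l) := by
  funext x
  simp only [QRel.pull, QRel.comp, comp_iSup, iSup_comp, Category.assoc]
  exact iSup_comm

theorem QRel.pull_mono {X Y : TypedSet 𝒬} {ζ ζ' : QRel X Y} (h : ζ ≤ ζ') {q : 𝒬} {l l' : PSh Y q}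
    (hl : l ≤ l') : ζ.pull l ≤ ζ'.pull l' :=
  fun x => iSup_mono fun y => comp_mono (h x y) (hl y)

theorem QRel.pull_sSup {X Y : TypedSet 𝒬} (ζ : QRel X Y) {q : 𝒬} {ι : Sort*} (l : ι → PSh Y q) :
    ζ.pull (⨆ i, l i) = ⨆ i, ζ.pull (l i) := by
  funext x
  simp only [QRel.pull, iSup_apply, comp_iSup]
  exact iSup_comm

theorem QRel.iSup_pull {X Y : TypedSet 𝒬} {q : 𝒬} {ι : Sort*} (ζ : ι → QRel X Y) (l : PSh Y q) :
    QRel.pull (⨆ i, ζ i) l = ⨆ i, (ζ i).pull l := by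
  funext x
  simp only [QRel.pull, iSup_apply, iSup_comp]
  exact iSup_comm

namespace ClosureSpace

theorem cl_comp_le (X : ClosureSpace 𝒬) {q q' : 𝒬} (μ : PSh X.toTypedSet q)
    (μ' : PSh X.toTypedSet q') (v : q ⟶ q') (h : ∀ x, μ x ≫ v ≤ μ' x) (x : X.carrier) :
    X.cl μ x ≫ v ≤ X.cl μ' x := by
  have h1 : v ≤ μ.hom μ' := le_iInf fun x => le_lda.2 (h x)
  exact le_lda.1 ((h1.trans (X.hom_le μ μ')).trans (iInf_le _ x))

theorem cl_mono (X : ClosureSpace 𝒬) {q : 𝒬} {μ μ' : PSh X.toTypedSet q} (h : μ ≤ μ') :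
    X.cl μ ≤ X.cl μ' := by
  intro x
  have := X.cl_comp_le μ μ' (𝟙 q) (fun x => by simpa using h x) x
  simpa using this

theorem pull_closure_le {X Y : ClosureSpace 𝒬} (ζ : QRel X.toTypedSet Y.toTypedSet) {q : 𝒬}
    (l : PSh Y.toTypedSet q) : ζ.closure.pull l ≤ X.cl (ζ.pull l) :=
  fun x => iSup_le fun y => X.cl_comp_le _ _ (l y)
    (fun x' => le_iSup (fun y => ζ x' y ≫ l y) y) x

theorem le_closure {X Y : ClosureSpace 𝒬} (ζ : QRel X.toTypedSet Y.toTypedSet) : ζ ≤ ζ.closure :=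
  fun x y => X.le_cl (fun x' => ζ x' y) x

theorem closure_mono {X Y : ClosureSpace 𝒬} {ζ ζ' : QRel X.toTypedSet Y.toTypedSet} (h : ζ ≤ ζ') :
    ζ.closure ≤ ζ'.closure :=
  fun x y => X.cl_mono (fun x' => h x' y) x

end ClosureSpace

/-- Continuous relations between closure spaces. -/
abbrev ContRel (X Y : ClosureSpace 𝒬) : Type u :=
  {ζ : QRel X.toTypedSet Y.toTypedSet // ζ.IsContinuous}

theorem QRel.IsContinuous.sSup {X Y : ClosureSpace 𝒬} (S : Set (ContRel X Y)) :
    QRel.IsContinuous (X := X) (Y := Y) (⨆ ζ ∈ S, (ζ : ContRel X Y).1) := by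
  intro q l
  simp only [QRel.iSup_pull]
  exact iSup₂_le fun ζ hζ => (ζ.2 q l).trans (X.cl_mono
    (le_iSup₂_of_le (f := fun (ζ : ContRel X Y) (_ : ζ ∈ S) => ζ.1.pull l) ζ hζ le_rfl))

/-- Joins of continuous relations are the pointwise joins. -/
instance (X Y : ClosureSpace 𝒬) : SupSet (ContRel X Y) :=
  ⟨fun S => ⟨⨆ ζ ∈ S, ζ.1, QRel.IsContinuous.sSup S⟩⟩

instance (X Y : ClosureSpace 𝒬) : CompleteLattice (ContRel X Y) :=
  completeLatticeOfSup _ fun S => ⟨fun ζ hζ => show ζ.1 ≤ _ from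
    le_iSup₂_of_le (f := fun (ζ : ContRel X Y) (_ : ζ ∈ S) => ζ.1) ζ hζ le_rfl,
    fun _ hη => (iSup₂_le fun ζ hζ => hη hζ : (⨆ ζ ∈ S, (ζ : ContRel X Y).1) ≤ _)⟩

/-- The quantaloid `𝒬`-`ClsRel` of closure spaces on typed sets and continuous relations. -/
noncomputable instance : Quantaloid.{u + 1, u} (ClosureSpace 𝒬) where
  Hom X Y := ContRel X Y
  id X := ⟨QRel.id X.toTypedSet, fun q l => by rw [QRel.pull_id, QRel.pull_id]⟩
  comp {X Y Z} ζ η := ⟨ζ.1.comp η.1, fun q l => by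
    rw [QRel.pull_comp, QRel.pull_comp]
    exact (QRel.pull_mono le_rfl (η.2 q l)).trans (ζ.2 q _)⟩
  id_comp ζ := Subtype.ext <| by
    funext x y
    exact congrFun (QRel.pull_id (fun x' => ζ.1 x' y)) x
  comp_id ζ := Subtype.ext (QRel.comp_id _)
  assoc ζ η θ := Subtype.ext <| by
    funext x w
    exact congrFun (QRel.pull_comp ζ.1 η.1 (fun z => θ.1 z w)) x
  homLattice X Y := inferInstanceAs (CompleteLattice (ContRel X Y))
  comp_sSup {X Y Z} ζ S := by
    refine le_antisymm ?_ (iSup₂_le fun η hη x z => ?_)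
    · intro x z
      change (⨆ y, ζ.1 x y ≫ (⨆ η ∈ S, (η : ContRel Y Z).1) y z) ≤ _
      simp only [iSup_apply, comp_iSup]
      refine iSup_le fun y => iSup₂_le fun η hη => ?_
      exact (le_iSup (fun y => ζ.1 x y ≫ η.1 y z) y).trans
        ((le_iSup₂_of_le (f := fun (η : ContRel Y Z) (_ : η ∈ S) =>
          (⟨ζ.1.comp η.1, _⟩ : ContRel X Z)) η hη le_rfl : _ ≤ _) x z)
    · exact iSup_mono fun y => comp_mono le_rfl ((le_sSup hη : η ≤ sSup S) y z)
  sSup_comp {X Y Z} S η := by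
    refine le_antisymm ?_ (iSup₂_le fun ζ hζ x z => ?_)
    · intro x z
      change (⨆ y, (⨆ ζ ∈ S, (ζ : ContRel X Y).1) x y ≫ η.1 y z) ≤ _
      simp only [iSup_apply, iSup_comp]
      refine iSup_le fun y => iSup₂_le fun ζ hζ => ?_
      exact (le_iSup (fun y => ζ.1 x y ≫ η.1 y z) y).trans
        ((le_iSup₂_of_le (f := fun (ζ : ContRel X Y) (_ : ζ ∈ S) =>
          (⟨ζ.1.comp η.1, _⟩ : ContRel X Z)) ζ hζ le_rfl : _ ≤ _) x z)
    · exact iSup_mono fun y => comp_mono ((le_sSup hζ : ζ ≤ sSup S) x y) le_rfl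

variable (𝒬) in
/-- The nucleus on `𝒬`-`ClsRel` that sends a continuous relation to its closure. -/
noncomputable def closureNucleus : QuantaloidNucleus (ClosureSpace 𝒬) where
  cl X Y := ClosureOperator.mk'
    (fun ζ : ContRel X Y => (⟨QRel.closure ζ.1, fun q l => by
      refine (ClosureSpace.pull_closure_le _ _).trans ?_
      refine (X.cl_mono (ζ.2 q l)).trans ((X.cl_cl_le _).trans (X.cl_mono ?_))
      exact QRel.pull_mono (ClosureSpace.le_closure _) le_rfl⟩ : ContRel X Y))
    (fun ζ ζ' h => ClosureSpace.closure_mono (Y := Y) (ζ := ζ.1) (ζ' := ζ'.1) h)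
    (fun ζ => ClosureSpace.le_closure ζ.1)
    (fun ζ x y => X.cl_cl_le (fun x' => ζ.1 x' y) x)
  cl_comp_cl_le {X Y _} ζ η := by
    intro x z
    refine (ClosureSpace.pull_closure_le (Y := Y) ζ.1 (Y.cl fun y => η.1 y z) x).trans ?_
    exact (X.cl_mono (ζ.2 _ fun y => η.1 y z) x).trans (X.cl_cl_le _ x)

variable (𝒬) in
/-- The quantaloid `(𝒬-ClsRel)_cl` of closure spaces and closed continuous relations: the quotient
of `𝒬`-`ClsRel` by the closure nucleus. Its arrows are the continuous relations `ζ` with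
`ζ.closure = ζ`, that is, those for which every presheaf `ζ(-, y)` is closed. -/
abbrev ClsRelCl : Type (u + 1) := QuotientQuantaloid (closureNucleus 𝒬)

end Closure

/-! ### Complete enriched categories and sup-preserving functors -/

/-- A category enriched in `𝒬`. -/
structure QCat (𝒬 : Type u) [Quantaloid.{u, u} 𝒬] extends TypedSet 𝒬 where
  hom : ∀ x y : carrier, type x ⟶ type y
  id_le : ∀ x, 𝟙 (type x) ≤ hom x x
  comp_le : ∀ x y z, hom x y ≫ hom y z ≤ hom x z

section Sup

variable {𝒬 : Type u} [Quantaloid.{u, u} 𝒬]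

namespace QCat

/-- The hom-arrow `X(x, y)`, read as an arrow `p ⟶ q` when `|x| = p` and `|y| = q`. -/
def homAs (X : QCat 𝒬) {p q : 𝒬} (x y : X.carrier) (hx : X.type x = p) (hy : X.type y = q) :
    p ⟶ q :=
  eqToHom hx.symm ≫ X.hom x y ≫ eqToHom hy

/-- The underlying preorder: `x ≤ y` iff `|x| = |y|` and `1 ≤ X(x, y)`. -/
def le (X : QCat 𝒬) (x y : X.carrier) : Prop :=
  ∃ h : X.type x = X.type y, 𝟙 (X.type y) ≤ X.homAs x y h rfl

/-- `X` is separated if its underlying preorder is antisymmetric. -/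
def IsSeparated (X : QCat 𝒬) : Prop := ∀ x y, X.le x y → X.le y x → x = y

/-- A family of arrows `μ x : |x| ⟶ q` is a presheaf on `X` (a distributor from `X` to `{q}`). -/
def IsPresheaf (X : QCat 𝒬) {q : 𝒬} (μ : PSh X.toTypedSet q) : Prop :=
  ∀ x x', X.hom x' x ≫ μ x ≤ μ x'

/-- `s` is a supremum of `μ`: it has the type `q` of `μ`, and `X(s, -) = X ↙ μ`. -/
def IsSup (X : QCat 𝒬) {q : 𝒬} (μ : PSh X.toTypedSet q) (s : X.carrier) : Prop :=
  ∃ h : X.type s = q, ∀ x, X.homAs s x h rfl = ⨅ y, lda (X.hom y x) (μ y)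

/-- `X` is complete if every presheaf on it has a supremum. -/
def IsComplete (X : QCat 𝒬) : Prop :=
  ∀ (q : 𝒬) (μ : PSh X.toTypedSet q), X.IsPresheaf μ → ∃ s, X.IsSup μ s

end QCat

/-- A functor of `𝒬`-categories: a type-preserving map with `X(x, x') ≤ Y(f x, f x')`. -/
@[ext]
structure QFunctor (X Y : QCat 𝒬) where
  toFun : X.carrier → Y.carrier
  type_eq : ∀ x, Y.type (toFun x) = X.type x
  hom_le : ∀ x x', X.hom x x' ≤ Y.homAs (toFun x) (toFun x') (type_eq x) (type_eq x')

/-- The image presheaf `f^→ μ` on `Y` of a presheaf `μ` on `X`, the composite of `μ` with the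
cograph `Y(-, f -)` of `f`. -/
def QFunctor.push {X Y : QCat 𝒬} (f : QFunctor X Y) {q : 𝒬} (μ : PSh X.toTypedSet q) :
    PSh Y.toTypedSet q :=
  fun y => ⨆ x, Y.homAs y (f.toFun x) rfl (f.type_eq x) ≫ μ x

/-- `f` preserves suprema: `f (sup μ) = sup (f^→ μ)`. -/
def QFunctor.IsSupPreserving {X Y : QCat 𝒬} (f : QFunctor X Y) : Prop :=
  ∀ (q : 𝒬) (μ : PSh X.toTypedSet q), X.IsPresheaf μ →
    ∀ s, X.IsSup μ s → Y.IsSup (f.push μ) (f.toFun s)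

theorem QCat.homAs_rfl (X : QCat 𝒬) (x y : X.carrier) : X.homAs x y rfl rfl = X.hom x y := by
  simp [QCat.homAs]

theorem QCat.id_le_homAs (X : QCat 𝒬) {p : 𝒬} (x : X.carrier) (hx : X.type x = p) :
    𝟙 p ≤ X.homAs x x hx hx := by
  subst hx
  rw [X.homAs_rfl]
  exact X.id_le x

theorem QCat.homAs_comp (X : QCat 𝒬) {p q r : 𝒬} {x y z : X.carrier} (hx : X.type x = p)
    (hy : X.type y = q) (hz : X.type z = r) :
    X.homAs x y hx hy ≫ X.homAs y z hy hz ≤ X.homAs x z hx hz := by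
  subst hx hy hz
  simp only [X.homAs_rfl]
  exact X.comp_le x y z

theorem QCat.le_iff (X : QCat 𝒬) {q : 𝒬} {x y : X.carrier} (hx : X.type x = q)
    (hy : X.type y = q) : X.le x y ↔ 𝟙 q ≤ X.homAs x y hx hy := by
  subst hy
  exact ⟨fun ⟨_, h⟩ => h, fun h => ⟨hx, h⟩⟩

theorem QCat.le_refl (X : QCat 𝒬) (x : X.carrier) : X.le x x :=
  ⟨rfl, X.id_le_homAs x rfl⟩

theorem QCat.le_trans (X : QCat 𝒬) {x y z : X.carrier} (h : X.le x y) (h' : X.le y z) :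
    X.le x z := by
  obtain ⟨hxy, h⟩ := h
  obtain ⟨hyz, h'⟩ := h'
  replace h := (X.le_iff rfl hxy.symm).1 ⟨hxy, h⟩
  replace h' := (X.le_iff hxy.symm (hxy.trans hyz).symm).1 ⟨hyz, h'⟩
  rw [X.le_iff rfl (hxy.trans hyz).symm]
  refine _root_.le_trans ?_ (X.homAs_comp rfl hxy.symm _)
  have := comp_mono h h'
  rwa [Category.id_comp] at this

theorem QFunctor.homAs_le {X Y : QCat 𝒬} (f : QFunctor X Y) {p q : 𝒬} {x x' : X.carrier}
    (hx : X.type x = p) (hx' : X.type x' = q) :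
    X.homAs x x' hx hx' ≤ Y.homAs (f.toFun x) (f.toFun x') ((f.type_eq x).trans hx)
      ((f.type_eq x').trans hx') := by
  subst hx hx'
  rw [X.homAs_rfl]
  exact f.hom_le x x'

theorem QFunctor.map_le {X Y : QCat 𝒬} (f : QFunctor X Y) {x x' : X.carrier} (h : X.le x x') :
    Y.le (f.toFun x) (f.toFun x') := by
  obtain ⟨e, h⟩ := h
  exact (Y.le_iff ((f.type_eq x).trans e) (f.type_eq x')).2 (h.trans (f.homAs_le e rfl))

theorem QCat.isSup_iff (X : QCat 𝒬) {q : 𝒬} {μ : PSh X.toTypedSet q} {s : X.carrier} :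
    X.IsSup μ s ↔ ∃ h : X.type s = q, ∀ (x : X.carrier) (v : q ⟶ X.type x),
      v ≤ X.homAs s x h rfl ↔ ∀ y, μ y ≫ v ≤ X.hom y x := by
  refine exists_congr fun h => forall_congr' fun x => ⟨fun e v => ?_, fun e => ?_⟩
  · rw [e, le_iInf_iff]
    exact forall_congr' fun y => le_lda
  · refine eq_of_forall_le_iff fun v => ?_
    rw [e, le_iInf_iff]
    exact forall_congr' fun y => le_lda.symm

theorem QFunctor.isSup_push_iff {X Y : QCat 𝒬} (f : QFunctor X Y) {q : 𝒬}
    {μ : PSh X.toTypedSet q} {t : Y.carrier} :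
    Y.IsSup (f.push μ) t ↔ ∃ h : Y.type t = q, ∀ (y : Y.carrier) (v : q ⟶ Y.type y),
      v ≤ Y.homAs t y h rfl ↔
        ∀ x, μ x ≫ v ≤ Y.homAs (f.toFun x) y (f.type_eq x) rfl := by
  rw [Y.isSup_iff]
  refine exists_congr fun h => forall_congr' fun y => forall_congr' fun v =>
    iff_congr Iff.rfl ⟨fun H x => ?_, fun H y' => ?_⟩
  · have h1 := H (f.toFun x)
    have h2 : eqToHom (f.type_eq x).symm ≫ Y.homAs (f.toFun x) (f.toFun x) rfl (f.type_eq x) =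
        Y.homAs (f.toFun x) (f.toFun x) (f.type_eq x) (f.type_eq x) := by
      simp [QCat.homAs]
    have h3 : μ x ≤ eqToHom (f.type_eq x).symm ≫ f.push μ (f.toFun x) := by
      rw [QFunctor.push, comp_iSup]
      refine le_iSup_of_le x ?_
      rw [← Category.assoc, h2]
      have := comp_mono (Y.id_le_homAs (f.toFun x) (f.type_eq x)) (_root_.le_refl (μ x))
      rwa [Category.id_comp] at this
    refine (comp_mono h3 le_rfl).trans ?_
    rw [Category.assoc]
    refine (comp_mono le_rfl h1).trans ?_
    simp [QCat.homAs]
  · rw [QFunctor.push, iSup_comp]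
    refine iSup_le fun x => ?_
    rw [Category.assoc, ← Y.homAs_rfl]
    exact (comp_mono le_rfl (H x)).trans (Y.homAs_comp _ _ _)

/-- The presheaf generated by a family `b` of elements of type `q`; its supremum is the join of the
family. -/
def QCat.joinPSh (X : QCat 𝒬) {ι : Type*} {q : 𝒬} (b : ι → X.carrier)
    (hb : ∀ i, X.type (b i) = q) : PSh X.toTypedSet q :=
  fun y => ⨆ i, X.homAs y (b i) rfl (hb i)

theorem QCat.isPresheaf_joinPSh (X : QCat 𝒬) {ι : Type*} {q : 𝒬} (b : ι → X.carrier)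
    (hb : ∀ i, X.type (b i) = q) : X.IsPresheaf (X.joinPSh b hb) := by
  intro x x'
  rw [QCat.joinPSh, comp_iSup]
  refine iSup_mono fun i => ?_
  rw [← X.homAs_rfl]
  exact X.homAs_comp _ _ _

theorem QCat.IsSup.type_eq {X : QCat 𝒬} {q : 𝒬} {μ : PSh X.toTypedSet q} {s : X.carrier}
    (h : X.IsSup μ s) : X.type s = q := h.1

theorem QCat.le_homAs_join (X : QCat 𝒬) {ι : Type*} {p q : 𝒬} {b : ι → X.carrier}
    {hb : ∀ i, X.type (b i) = q} {s : X.carrier} (hs : X.IsSup (X.joinPSh b hb) s) {y : X.carrier}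
    (hy : X.type y = p) (v : q ⟶ p) :
    v ≤ X.homAs s y hs.type_eq hy ↔ ∀ i, v ≤ X.homAs (b i) y (hb i) hy := by
  subst hy
  obtain ⟨h, hs⟩ := X.isSup_iff.1 hs
  rw [hs]
  refine ⟨fun H i => ?_, fun H y' => ?_⟩
  · obtain rfl := hb i
    have h1 := H (b i)
    have h2 : 𝟙 _ ≤ X.joinPSh b hb (b i) :=
      (X.id_le_homAs (b i) rfl).trans (le_iSup (fun j => X.homAs (b i) (b j) rfl (hb j)) i)
    have h3 := (comp_mono h2 (_root_.le_refl v)).trans h1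
    rwa [Category.id_comp, ← X.homAs_rfl] at h3
  · rw [QCat.joinPSh, iSup_comp]
    refine iSup_le fun i => (comp_mono le_rfl (H i)).trans ?_
    rw [← X.homAs_rfl]
    exact X.homAs_comp _ _ _

variable (𝒬) in
/-- Separated complete `𝒬`-categories. -/
structure QSup extends QCat 𝒬 where
  separated : toQCat.IsSeparated
  complete : toQCat.IsComplete

/-- Sup-preserving functors. -/
abbrev SupMap (X Y : QSup 𝒬) : Type u := {f : QFunctor X.toQCat Y.toQCat // f.IsSupPreserving}

namespace SupMap

variable {X Y Z : QSup 𝒬}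

/-- Sup-preserving functors are ordered pointwise, by the underlying order of the codomain. -/
instance : PartialOrder (SupMap X Y) where
  le f g := ∀ x, Y.le (f.1.toFun x) (g.1.toFun x)
  le_refl f x := Y.le_refl _
  le_trans f g h hfg hgh x := Y.le_trans (hfg x) (hgh x)
  le_antisymm f g hfg hgf := Subtype.ext <| QFunctor.ext <| funext fun x =>
    Y.separated _ _ (hfg x) (hgf x)

/-- The pointwise join of a set of sup-preserving functors. -/
noncomputable def join (S : Set (SupMap X Y)) (x : X.carrier) : Y.carrier :=
  (Y.complete _ _ (Y.isPresheaf_joinPSh (fun f : S => f.1.1.toFun x)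
    (fun f => f.1.1.type_eq x))).choose

theorem isSup_join (S : Set (SupMap X Y)) (x : X.carrier) :
    Y.IsSup (Y.joinPSh (fun f : S => f.1.1.toFun x) (fun f => f.1.1.type_eq x)) (join S x) :=
  (Y.complete _ _ (Y.isPresheaf_joinPSh (fun f : S => f.1.1.toFun x)
    (fun f => f.1.1.type_eq x))).choose_spec

theorem le_homAs_join' (S : Set (SupMap X Y)) {p q : 𝒬} {x : X.carrier} (hx : X.type x = q)
    {y : Y.carrier} (hy : Y.type y = p) (v : q ⟶ p) :
    v ≤ Y.homAs (join S x) y ((isSup_join S x).type_eq.trans hx) hy ↔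
      ∀ f ∈ S, v ≤ Y.homAs (f.1.toFun x) y ((f.1.type_eq x).trans hx) hy := by
  subst hx
  exact (Y.le_homAs_join (isSup_join S x) hy v).trans Subtype.forall

theorem le_join (S : Set (SupMap X Y)) {f : SupMap X Y} (hf : f ∈ S) (x : X.carrier) :
    Y.le (f.1.toFun x) (join S x) := by
  rw [Y.le_iff (f.1.type_eq x) (isSup_join S x).type_eq]
  exact (le_homAs_join' S rfl (isSup_join S x).type_eq _).1 (Y.id_le_homAs _ _) f hf

theorem join_le (S : Set (SupMap X Y)) {x : X.carrier} {y : Y.carrier} (hy : Y.type y = X.type x)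
    (h : ∀ f ∈ S, Y.le (f.1.toFun x) y) : Y.le (join S x) y := by
  rw [Y.le_iff (isSup_join S x).type_eq hy]
  exact (le_homAs_join' S rfl hy _).2 fun f hf => (Y.le_iff (f.1.type_eq x) hy).1 (h f hf)

/-- The pointwise join as a functor. -/
noncomputable def joinFunctor (S : Set (SupMap X Y)) : QFunctor X.toQCat Y.toQCat where
  toFun := join S
  type_eq x := (isSup_join S x).type_eq
  hom_le x x' := by
    refine (le_homAs_join' S rfl _ _).2 fun f hf => ?_
    have h := (Y.le_iff (f.1.type_eq x') (isSup_join S x').type_eq).1 (le_join S hf x')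
    have := comp_mono (f.1.hom_le x x') h
    rw [Category.comp_id] at this
    exact this.trans (Y.homAs_comp _ _ _)

theorem joinFunctor_isSupPreserving (S : Set (SupMap X Y)) :
    (joinFunctor S).IsSupPreserving := by
  intro q μ hμ s hs
  refine (joinFunctor S).isSup_push_iff.2 ⟨(isSup_join S s).type_eq.trans hs.type_eq,
    fun y v => ?_⟩
  change v ≤ Y.homAs (join S s) y _ _ ↔ ∀ x, μ x ≫ v ≤ Y.homAs (join S x) y _ _
  rw [le_homAs_join' S hs.type_eq rfl]
  have h1 : ∀ f ∈ S, (v ≤ Y.homAs (f.1.toFun s) y ((f.1.type_eq s).trans hs.type_eq) rfl ↔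
      ∀ x, μ x ≫ v ≤ Y.homAs (f.1.toFun x) y (f.1.type_eq x) rfl) := fun f _ => by
    obtain ⟨_, h⟩ := f.1.isSup_push_iff.1 (f.2 q μ hμ s hs)
    exact h y v
  rw [forall₂_congr h1]
  refine ⟨fun H x => (le_homAs_join' S rfl rfl _).2 fun f hf => H f hf x, fun H f hf x =>
    (le_homAs_join' S rfl rfl _).1 (H x) f hf⟩

noncomputable instance : SupSet (SupMap X Y) :=
  ⟨fun S => ⟨joinFunctor S, joinFunctor_isSupPreserving S⟩⟩

noncomputable instance : CompleteLattice (SupMap X Y) :=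
  completeLatticeOfSup _ fun S => ⟨fun _ hf x => le_join S hf x,
    fun g hg x => join_le S (g.1.type_eq x) fun _ hf => hg hf x⟩

/-- The identity functor. -/
def id (X : QSup 𝒬) : SupMap X X :=
  ⟨{ toFun := fun x => x
     type_eq := fun _ => rfl
     hom_le := fun x x' => (X.homAs_rfl x x').ge },
    fun q μ hμ s hs => by
      have h : ∀ (y : X.carrier) (v : q ⟶ X.type y), _ :=
        (X.isSup_iff.1 hs).2
      refine (QFunctor.isSup_push_iff _).2 ⟨hs.type_eq, fun y v => (h y v).trans ?_⟩
      simp only [X.homAs_rfl]⟩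

/-- The composite `g ∘ f`. -/
def comp (f : SupMap X Y) (g : SupMap Y Z) : SupMap X Z :=
  ⟨{ toFun := fun x => g.1.toFun (f.1.toFun x)
     type_eq := fun x => (g.1.type_eq _).trans (f.1.type_eq x)
     hom_le := fun x x' => (f.1.hom_le x x').trans (g.1.homAs_le _ _) },
    fun q μ hμ s hs => by
      have h1 := f.2 q μ hμ s hs
      have h2 := g.2 q _ (fun y y' => by
        rw [QFunctor.push, comp_iSup]
        refine iSup_mono fun x => ?_
        rw [← Category.assoc, ← Y.homAs_rfl]
        exact comp_mono (Y.homAs_comp _ _ _) le_rfl) _ h1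
      obtain ⟨h, H⟩ := g.1.isSup_push_iff.1 h2
      refine (QFunctor.isSup_push_iff _).2 ⟨h, fun z v => (H z v).trans ?_⟩
      refine ⟨fun K x => ?_, fun K y => ?_⟩
      · have h3 := K (f.1.toFun x)
        have h4 : μ x ≤ eqToHom (f.1.type_eq x).symm ≫ f.1.push μ (f.1.toFun x) := by
          rw [QFunctor.push, comp_iSup]
          refine le_iSup_of_le x ?_
          have := comp_mono (Y.id_le_homAs (f.1.toFun x) (f.1.type_eq x)) (_root_.le_refl (μ x))
          rw [Category.id_comp] at this
          refine this.trans (le_of_eq ?_)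
          simp [QCat.homAs]
        refine (comp_mono h4 le_rfl).trans ?_
        rw [Category.assoc]
        refine (comp_mono le_rfl h3).trans ?_
        simp [QCat.homAs]
      · rw [QFunctor.push, iSup_comp]
        refine iSup_le fun x => ?_
        rw [Category.assoc]
        exact (comp_mono (g.1.homAs_le _ _) (K x)).trans (Z.homAs_comp _ _ _)⟩

theorem map_join_le (S : Set (SupMap X Y)) (g : SupMap Y Z) {x : X.carrier} {z : Z.carrier}
    (hz : Z.type z = X.type x) (h : ∀ f ∈ S, Z.le (g.1.toFun (f.1.toFun x)) z) :
    Z.le (g.1.toFun (join S x)) z := by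
  have h1 := g.2 _ _ (Y.isPresheaf_joinPSh _ _) _ (isSup_join S x)
  obtain ⟨h2, H⟩ := g.1.isSup_push_iff.1 h1
  rw [Z.le_iff (h2.trans hz.symm) rfl]
  have h3 := (H z (eqToHom hz.symm)).2 fun y => by
    rw [QCat.joinPSh, iSup_comp]
    refine iSup_le fun f => ?_
    have h4 := (Z.le_iff (((g.1.type_eq _).trans (f.1.1.type_eq x)).trans hz.symm) rfl).1
      (h f.1 f.2)
    refine (comp_mono (g.1.homAs_le rfl (f.1.1.type_eq x))
      (?_ : _ ≤ Z.homAs (g.1.toFun (f.1.1.toFun x)) z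
        ((g.1.type_eq _).trans (f.1.1.type_eq x)) rfl)).trans (Z.homAs_comp _ _ _)
    have := comp_mono (_root_.le_refl (eqToHom hz.symm)) h4
    rw [Category.comp_id] at this
    refine this.trans (le_of_eq ?_)
    simp [QCat.homAs]
  have := comp_mono (_root_.le_refl (eqToHom hz)) h3
  simp only [eqToHom_trans, eqToHom_refl] at this
  refine this.trans (le_of_eq ?_)
  simp [QCat.homAs]

end SupMap

/-- The quantaloid `𝒬`-`Sup` of separated complete `𝒬`-categories and sup-preserving functors, with
the pointwise order on functors. -/
noncomputable instance : Quantaloid.{u + 1, u} (QSup 𝒬) where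
  Hom X Y := SupMap X Y
  id X := SupMap.id X
  comp f g := f.comp g
  id_comp _ := rfl
  comp_id _ := rfl
  assoc _ _ _ := rfl
  homLattice X Y := inferInstanceAs (CompleteLattice (SupMap X Y))
  comp_sSup {X Y Z} f S := by
    refine le_antisymm (fun x => ?_) (iSup₂_le fun g hg x => SupMap.le_join S hg (f.1.toFun x))
    refine SupMap.join_le S ((Subtype.val (p := QFunctor.IsSupPreserving) _).type_eq x |>.trans
      (f.1.type_eq x).symm) fun g hg => ?_
    exact (le_iSup₂_of_le (f := fun (g : SupMap Y Z) (_ : g ∈ S) => f.comp g) g hg le_rfl :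
      f.comp g ≤ _) x
  sSup_comp {X Y Z} S g := by
    refine le_antisymm (fun x => ?_) (iSup₂_le fun f hf x => g.1.map_le (SupMap.le_join S hf x))
    refine SupMap.map_join_le S g ((Subtype.val (p := QFunctor.IsSupPreserving) _).type_eq x)
      fun f hf => ?_
    exact (le_iSup₂_of_le (f := fun (f : SupMap X Y) (_ : f ∈ S) => f.comp g) f hf le_rfl :
      f.comp g ≤ _) x

end Sup

/-! ### Divisible quantales and fuzzy sets -/

open Quantale

/-- A unital quantale is divisible if `x ≤ y` implies `y * a = x = b * y` for some `a`, `b`. -/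
class IsDivisibleQuantale (Q : Type u) [Monoid Q] [CompleteLattice Q] [IsQuantale Q] : Prop where
  exists_mul_eq : ∀ x y : Q, x ≤ y → ∃ a b : Q, y * a = x ∧ x = b * y

section Divisible

variable {Q : Type u} [Monoid Q] [CompleteLattice Q] [IsQuantale Q] [IsDivisibleQuantale Q]

theorem le_one' (x : Q) : x ≤ 1 := by
  obtain ⟨a, b, h1, h2⟩ := IsDivisibleQuantale.exists_mul_eq (1 : Q) ⊤ le_top
  have h3 : (⊤ : Q) * ⊤ ≤ ⊤ := le_top
  calc x ≤ ⊤ := le_top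
    _ = ⊤ * ((⊤ : Q) * a) := by rw [h1, mul_one]
    _ = (⊤ * ⊤) * a := (mul_assoc _ _ _).symm
    _ ≤ ⊤ * a := mul_le_mul_left h3 a
    _ = 1 := h1

theorem mul_rres {x y : Q} (h : x ≤ y) : y * (y ⇨ᵣ x) = x := by
  obtain ⟨a, _, h1, -⟩ := IsDivisibleQuantale.exists_mul_eq x y h
  refine le_antisymm (rightMulResiduation_le_iff_mul_le.1 le_rfl) ?_
  calc x = y * a := h1.symm
    _ ≤ y * (y ⇨ᵣ x) := mul_le_mul_right (rightMulResiduation_le_iff_mul_le.2 h1.le) y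

theorem lres_mul {x y : Q} (h : x ≤ y) : (y ⇨ₗ x) * y = x := by
  obtain ⟨_, b, -, h1⟩ := IsDivisibleQuantale.exists_mul_eq x y h
  refine le_antisymm (leftMulResiduation_le_iff_mul_le.1 le_rfl) ?_
  calc x = b * y := h1
    _ ≤ (y ⇨ₗ x) * y := mul_le_mul_left (leftMulResiduation_le_iff_mul_le.2 h1.ge) y

/-- The two formulas for the composite of `u : x ⟶ y` and `v : y ⟶ z` agree. -/
theorem mul_rres_eq_lres_mul {u v y : Q} (hu : u ≤ y) (hv : v ≤ y) :
    v * (y ⇨ᵣ u) = (y ⇨ₗ v) * u := by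
  conv_lhs => rw [← lres_mul hv, mul_assoc, mul_rres hu]

end Divisible

/-- The objects of the quantaloid `D(Q)`: the elements of `Q`. -/
structure DQ (Q : Type u) where
  val : Q

/-- The quantaloid `D(Q)` of a divisible unital quantale `Q`: an arrow `x ⟶ y` is an element
`u ≤ x ⊓ y` of `Q`, ordered as in `Q`; the composite of `u : x ⟶ y` and `v : y ⟶ z` is
`v * (y ⇨ᵣ u)`, which equals `(y ⇨ₗ v) * u`; the identity of `x` is `x`. -/
instance (Q : Type u) [Monoid Q] [CompleteLattice Q] [IsQuantale Q] [IsDivisibleQuantale Q] :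
    Quantaloid.{u, u} (DQ Q) where
  Hom x y := Set.Iic (x.val ⊓ y.val)
  id x := ⟨x.val, by simp⟩
  comp {x y z} u v := ⟨v.1 * (y.val ⇨ᵣ u.1), by
    have hu := u.2
    have hv := v.2
    simp only [Set.mem_Iic, le_inf_iff] at hu hv ⊢
    constructor
    · rw [mul_rres_eq_lres_mul hu.2 hv.1]
      exact (mul_le_mul_left (le_one' _) _).trans ((one_mul _).le.trans hu.1)
    · exact (mul_le_mul_right (le_one' _) _).trans ((mul_one _).le.trans hv.2)⟩
  id_comp {x y} u := Subtype.ext <| by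
    have hu := u.2
    simp only [Set.mem_Iic, le_inf_iff] at hu
    change u.1 * (x.val ⇨ᵣ x.val) = u.1
    rw [mul_rres_eq_lres_mul le_rfl hu.1, lres_mul hu.1]
  comp_id {x y} u := Subtype.ext <| by
    have hu := u.2
    simp only [Set.mem_Iic, le_inf_iff] at hu
    exact mul_rres hu.2
  assoc {w x y z} t u v := Subtype.ext <| by
    have ht := t.2
    have hu := u.2
    have hv := v.2
    simp only [Set.mem_Iic, le_inf_iff] at ht hu hv
    have hc : u.1 * (x.val ⇨ᵣ t.1) ≤ y.val :=
      (mul_le_mul_right (le_one' _) _).trans ((mul_one _).le.trans hu.2)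
    change v.1 * (y.val ⇨ᵣ (u.1 * (x.val ⇨ᵣ t.1))) = (v.1 * (y.val ⇨ᵣ u.1)) * (x.val ⇨ᵣ t.1)
    rw [mul_rres_eq_lres_mul hc hv.1, mul_rres_eq_lres_mul hu.2 hv.1, mul_assoc]
  homLattice x y := inferInstanceAs (CompleteLattice (Set.Iic (x.val ⊓ y.val)))
  comp_sSup {x y z} u S := by
    refine Subtype.ext ?_
    change (sSup (Subtype.val '' S)) * (y.val ⇨ᵣ u.1) = _
    rw [sSup_mul_distrib, iSup_image, Set.Iic.coe_iSup]
    simp only [Set.Iic.coe_iSup]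
  sSup_comp {x y z} S v := by
    have hv := v.2
    simp only [Set.mem_Iic, le_inf_iff] at hv
    refine Subtype.ext ?_
    change v.1 * (y.val ⇨ᵣ (sSup (Subtype.val '' S))) = _
    have hS : sSup (Subtype.val '' S) ≤ y.val := by
      refine sSup_le ?_
      rintro _ ⟨u, -, rfl⟩
      exact (le_inf_iff.1 u.2).2
    rw [mul_rres_eq_lres_mul hS hv.1, mul_sSup_distrib, iSup_image, Set.Iic.coe_iSup]
    simp only [Set.Iic.coe_iSup]
    refine iSup_congr fun u => iSup_congr fun _ => ?_
    exact (mul_rres_eq_lres_mul (le_inf_iff.1 u.2).2 hv.1).symm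

/-- The quantaloid of fuzzy closure spaces on fuzzy sets (sets `X` with a membership map to `Q`) and
closed continuous fuzzy relations. -/
abbrev FuzzyClsRelCl (Q : Type u) [Monoid Q] [CompleteLattice Q] [IsQuantale Q]
    [IsDivisibleQuantale Q] : Type (u + 1) :=
  ClsRelCl (DQ Q)

/-- The quantaloid of separated complete preordered fuzzy sets and sup-preserving maps. -/
abbrev FuzzySup (Q : Type u) [Monoid Q] [CompleteLattice Q] [IsQuantale Q]
    [IsDivisibleQuantale Q] : Type (u + 1) :=
  QSup (DQ Q)

end FuzzyClosure

namespace FuzzyClosure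

section

variable {𝒬 : Type u} [Quantaloid.{u, u} 𝒬]

/-! ### Weighted joins in enriched categories -/

/-! The argument works over an arbitrary small quantaloid `𝒬`; the fuzzy statement is the case `𝒬 =
DQ Q`. The equivalence is `closedPShFunctor`: a closure space `(X, c)` goes to the `𝒬`-category of
presheaves fixed by `c`, and a relation `ζ : X → Y` goes to `l ↦ c (l ∘ ζ)`, from closed presheaves
on `Y` to those on `X`. This map preserves suprema because it has a right adjoint, `ContRel.push ζ`;
continuity of `ζ` is what makes `push` keep closed presheaves closed.

Fullness: a closed presheaf on `Y` is the join of the closed representables weighted by its own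
values (`isWeightedJoin_generate`). A sup-preserving functor is therefore determined by its values
on representables, and these are the columns of a closed continuous relation
(`exists_closedMap_eq`). Comparing columns also shows that the order of relations is preserved and
reflected (`closedMap_le_iff`), so the functor is an order isomorphism on hom-sets and preserves
joins.

Essential surjectivity: a separated complete `A` carries the closure `μ ↦ A(-, sup μ)` on its set of
elements. Its closed presheaves are exactly the representables, so `x ↦ A(-, x)` and `sup` are
mutually inverse (`closedSupIso`).

Types of elements often agree only propositionally; `homAs` and `ClosedPSh.as` carry the transports.
-/

theorem PSh.le_hom {X : TypedSet 𝒬} {q q' : 𝒬} {μ : PSh X q} {μ' : PSh X q'} {v : q ⟶ q'} :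
    v ≤ μ.hom μ' ↔ ∀ x, μ x ≫ v ≤ μ' x := by
  rw [PSh.hom, le_iInf_iff]
  exact forall_congr' fun x => le_lda

namespace QCat

/-- `s` is the join of the family `b` weighted by the arrows `w i : |b i| ⟶ q`. -/
def IsWeightedJoin (X : QCat 𝒬) {ι : Type*} {q : 𝒬} (b : ι → X.carrier)
    (w : ∀ i, X.type (b i) ⟶ q) (s : X.carrier) : Prop :=
  ∃ h : X.type s = q, ∀ (p : 𝒬) (y : X.carrier) (hy : X.type y = p) (v : q ⟶ p),
    v ≤ X.homAs s y h hy ↔ ∀ i, w i ≫ v ≤ X.homAs (b i) y rfl hy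

/-- The presheaf whose suprema are the joins of `b` weighted by `w`. -/
def weightedPSh (X : QCat 𝒬) {ι : Type*} {q : 𝒬} (b : ι → X.carrier)
    (w : ∀ i, X.type (b i) ⟶ q) : PSh X.toTypedSet q :=
  fun y => ⨆ i, X.hom y (b i) ≫ w i

theorem isPresheaf_weightedPSh (X : QCat 𝒬) {ι : Type*} {q : 𝒬} (b : ι → X.carrier)
    (w : ∀ i, X.type (b i) ⟶ q) : X.IsPresheaf (X.weightedPSh b w) := by
  intro x x'
  rw [weightedPSh, comp_iSup]
  refine iSup_mono fun i => ?_
  rw [← Category.assoc]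
  exact comp_mono (X.comp_le _ _ _) le_rfl

theorem le_weightedPSh (X : QCat 𝒬) {ι : Type*} {q : 𝒬} (b : ι → X.carrier)
    (w : ∀ i, X.type (b i) ⟶ q) (i : ι) : w i ≤ X.weightedPSh b w (b i) := by
  refine le_iSup_of_le (f := fun j => X.hom (b i) (b j) ≫ w j) i ?_
  have := comp_mono (X.id_le (b i)) (_root_.le_refl (w i))
  rwa [Category.id_comp] at this

/-- An arrow that bounds the weights `w i` also bounds the presheaf they generate, by composing with
`X(-, b i)`. This extends completeness and sup-preservation, both stated for presheaves, to
arbitrary weighted families. -/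
theorem isSup_weightedPSh_iff (X : QCat 𝒬) {ι : Type*} {q : 𝒬} {b : ι → X.carrier}
    {w : ∀ i, X.type (b i) ⟶ q} {s : X.carrier} :
    X.IsSup (X.weightedPSh b w) s ↔ X.IsWeightedJoin b w s := by
  have key : ∀ (y : X.carrier) (v : q ⟶ X.type y),
      (∀ x, X.weightedPSh b w x ≫ v ≤ X.hom x y) ↔ ∀ i, w i ≫ v ≤ X.hom (b i) y := by
    refine fun y v => ⟨fun H i => (comp_mono (X.le_weightedPSh b w i) le_rfl).trans (H _),
      fun H x => ?_⟩
    rw [weightedPSh, iSup_comp]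
    refine iSup_le fun i => ?_
    rw [Category.assoc]
    exact (comp_mono le_rfl (H i)).trans (X.comp_le _ _ _)
  rw [X.isSup_iff]
  refine exists_congr fun h => ⟨fun H p y hy v => ?_, fun H y v => ?_⟩
  · subst hy
    simp only [homAs_rfl]
    exact (H y v).trans (key y v)
  · rw [H _ y rfl v, key]
    simp only [homAs_rfl]

theorem IsComplete.exists_isWeightedJoin {X : QCat 𝒬} (hX : X.IsComplete) {ι : Type*} {q : 𝒬}
    (b : ι → X.carrier) (w : ∀ i, X.type (b i) ⟶ q) : ∃ s, X.IsWeightedJoin b w s :=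
  (hX q _ (X.isPresheaf_weightedPSh b w)).imp fun _ => X.isSup_weightedPSh_iff.1

theorem IsSeparated.eq_of_forall_le_homAs_iff {X : QCat 𝒬} (hX : X.IsSeparated) {q : 𝒬}
    {s t : X.carrier} (hs : X.type s = q) (ht : X.type t = q)
    (H : ∀ (y : X.carrier) (v : q ⟶ X.type y),
      v ≤ X.homAs s y hs rfl ↔ v ≤ X.homAs t y ht rfl) : s = t := by
  subst hs
  refine hX _ _ ⟨ht.symm, ?_⟩ ?_
  · have h1 : ∀ (p : 𝒬) (hp : X.type t = p) (v : X.type s ⟶ p),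
        v ≤ X.homAs t t ht hp → v ≤ X.homAs s t rfl hp := by
      rintro p rfl v
      exact (H t v).2
    rw [← le_iff X ht.symm rfl]
    exact (X.le_iff rfl ht).2 (h1 _ ht _ (X.id_le_homAs t ht))
  · exact (X.le_iff ht rfl).2 ((H s _).1 (X.id_le_homAs s rfl))

end QCat

/-- Preservation of weighted joins, written as a universal property: the image of the generated
presheaf is generated by the elements `f (b i)`. Fullness rests on it. -/
theorem QFunctor.IsSupPreserving.le_homAs_iff {X Y : QCat 𝒬} {f : QFunctor X Y}
    (hf : f.IsSupPreserving) {ι : Type*} {q : 𝒬} {b : ι → X.carrier} {w : ∀ i, X.type (b i) ⟶ q}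
    {s : X.carrier} (hs : X.IsWeightedJoin b w s) (y : Y.carrier) (v : q ⟶ Y.type y) :
    v ≤ Y.homAs (f.toFun s) y ((f.type_eq s).trans hs.1) rfl ↔
      ∀ i, w i ≫ v ≤ Y.homAs (f.toFun (b i)) y (f.type_eq (b i)) rfl := by
  obtain ⟨h, H⟩ := f.isSup_push_iff.1
    (hf q _ (X.isPresheaf_weightedPSh b w) s (X.isSup_weightedPSh_iff.2 hs))
  rw [H]
  refine ⟨fun K i => (comp_mono (X.le_weightedPSh b w i) le_rfl).trans (K _), fun K x => ?_⟩
  rw [QCat.weightedPSh, iSup_comp]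
  refine iSup_le fun i => ?_
  rw [Category.assoc]
  exact (comp_mono (f.hom_le x (b i)) (K i)).trans (Y.homAs_comp _ _ _)

/-- Left adjoints preserve suprema. -/
theorem QFunctor.isSupPreserving_of_adjoint {X Y : QCat 𝒬} (f : QFunctor X Y)
    (g : Y.carrier → X.carrier) (hg : ∀ y, X.type (g y) = Y.type y)
    (H : ∀ x y, Y.homAs (f.toFun x) y (f.type_eq x) rfl = X.homAs x (g y) rfl (hg y)) :
    f.IsSupPreserving := by
  intro q μ hμ s hs
  obtain ⟨rfl, hs⟩ := X.isSup_iff.1 hs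
  refine f.isSup_push_iff.2 ⟨f.type_eq s, fun y v => ?_⟩
  have h1 : ∀ (p : 𝒬) (hp : X.type (g y) = p) (v : X.type s ⟶ p),
      v ≤ X.homAs s (g y) rfl hp ↔ ∀ x, μ x ≫ v ≤ X.homAs x (g y) rfl hp := by
    rintro p rfl v
    rw [hs]
    simp only [X.homAs_rfl]
  simp only [H, h1]

/-! ### The category of closed presheaves -/

/-- The closed presheaves of a closure space. -/
structure ClosedPSh (X : ClosureSpace 𝒬) where
  type : 𝒬
  psh : PSh X.toTypedSet type
  cl_le : X.cl psh ≤ psh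

namespace ClosureSpace

theorem cl_le_iff (X : ClosureSpace 𝒬) {q : 𝒬} {μ μ' : PSh X.toTypedSet q} (h : X.cl μ' ≤ μ') :
    X.cl μ ≤ μ' ↔ μ ≤ μ' :=
  ⟨(X.le_cl μ).trans, fun hμ => (X.cl_mono hμ).trans h⟩

/-- The enriched form of `cl_le_iff`: the closure is a reflection onto closed presheaves. One
direction is `μ ≤ cl μ`, the other functoriality of `cl` and closedness of `μ'`. -/
theorem le_hom_cl_iff (X : ClosureSpace 𝒬) {q q' : 𝒬} {μ : PSh X.toTypedSet q}
    {μ' : PSh X.toTypedSet q'} (h : X.cl μ' ≤ μ') {v : q ⟶ q'} :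
    v ≤ (X.cl μ).hom μ' ↔ v ≤ μ.hom μ' := by
  simp only [PSh.le_hom]
  exact ⟨fun H x => (comp_mono (X.le_cl μ x) le_rfl).trans (H x),
    fun H x => (X.cl_comp_le μ μ' v H x).trans (h x)⟩

/-- The category of closed presheaves of a closure space. -/
abbrev closedCat (X : ClosureSpace 𝒬) : QCat 𝒬 where
  carrier := ClosedPSh X
  type e := e.type
  hom e e' := e.psh.hom e'.psh
  id_le e := PSh.le_hom.2 fun x => (Category.comp_id _).le
  comp_le e e' e'' := PSh.le_hom.2 fun x => by
    rw [← Category.assoc]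
    exact (comp_mono (PSh.le_hom.1 le_rfl x) le_rfl).trans (PSh.le_hom.1 le_rfl x)

end ClosureSpace

namespace ClosedPSh

variable {X Y : ClosureSpace 𝒬}

/-- A closed presheaf of type `|e|`, read as a presheaf of type `q` when `|e| = q`. -/
def as (e : ClosedPSh X) {q : 𝒬} (h : e.type = q) : PSh X.toTypedSet q :=
  fun x => e.psh x ≫ eqToHom h

theorem as_rfl (e : ClosedPSh X) : e.as rfl = e.psh := by
  funext x
  simp [as]

theorem cl_as_le (e : ClosedPSh X) {q : 𝒬} (h : e.type = q) : X.cl (e.as h) ≤ e.as h := by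
  subst h
  rw [as_rfl]
  exact e.cl_le

theorem homAs_eq (e e' : ClosedPSh X) {q q' : 𝒬} (h : e.type = q) (h' : e'.type = q') :
    X.closedCat.homAs e e' h h' = (e.as h).hom (e'.as h') := by
  subst h h'
  rw [as_rfl, as_rfl]
  exact X.closedCat.homAs_rfl e e'

theorem le_homAs_iff {e e' : ClosedPSh X} {q q' : 𝒬} {h : e.type = q} {h' : e'.type = q'}
    {v : q ⟶ q'} : v ≤ X.closedCat.homAs e e' h h' ↔ v ≤ (e.as h).hom (e'.as h') := by
  rw [homAs_eq]

theorem le_homAs_rfl_iff (e e' : ClosedPSh X) {v : e.type ⟶ e'.type} :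
    v ≤ X.closedCat.homAs e e' rfl rfl ↔ v ≤ e.psh.hom e'.psh :=
  iff_of_eq (congrArg (v ≤ ·) (X.closedCat.homAs_rfl e e'))

theorem le_iff (e e' : ClosedPSh X) {q : 𝒬} (h : e.type = q) (h' : e'.type = q) :
    X.closedCat.le e e' ↔ e.as h ≤ e'.as h' := by
  rw [X.closedCat.le_iff h h', homAs_eq, PSh.le_hom]
  exact forall_congr' fun x => by rw [Category.comp_id]

theorem mk_le_mk {q : 𝒬} {μ μ' : PSh X.toTypedSet q} (h : X.cl μ ≤ μ) (h' : X.cl μ' ≤ μ') :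
    X.closedCat.le ⟨q, μ, h⟩ ⟨q, μ', h'⟩ ↔ μ ≤ μ' := by
  rw [le_iff ⟨q, μ, h⟩ ⟨q, μ', h'⟩ rfl rfl, as_rfl, as_rfl]

/-- The closure of the presheaf on `Y` represented by `y`. -/
noncomputable def representable (Y : ClosureSpace 𝒬) (y : Y.carrier) : ClosedPSh Y :=
  ⟨Y.type y, Y.cl fun y' => QRel.id Y.toTypedSet y' y, Y.cl_cl_le _⟩

/-- The Yoneda lemma for closed presheaves. -/
theorem representable_hom (y : Y.carrier) {q : 𝒬} {μ : PSh Y.toTypedSet q} (h : Y.cl μ ≤ μ)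
    (v : Y.type y ⟶ q) : v ≤ (representable Y y).psh.hom μ ↔ v ≤ μ y := by
  refine (Y.le_hom_cl_iff h).trans (PSh.le_hom.trans ⟨fun H => ?_, fun H x => ?_⟩)
  · simpa [QRel.id] using H y
  · unfold QRel.id
    split_ifs with hxy
    · subst hxy
      simpa using H
    · rw [← sSup_empty, Quantaloid.sSup_comp]
      simp

/-- The closed presheaf generated by a presheaf. -/
abbrev generate (Y : ClosureSpace 𝒬) {q : 𝒬} (l : PSh Y.toTypedSet q) : ClosedPSh Y :=
  ⟨q, Y.cl l, Y.cl_cl_le l⟩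

theorem generate_inj {q : 𝒬} {l l' : PSh Y.toTypedSet q} :
    generate Y l = generate Y l' ↔ Y.cl l = Y.cl l' := by
  simp [generate]

theorem generate_psh (e : ClosedPSh Y) : generate Y e.psh = e := by
  obtain ⟨q, l, h⟩ := e
  have : Y.cl l = l := le_antisymm h (Y.le_cl l)
  simp [generate, this]

/-- The closed presheaf generated by `l` is the join of the representables weighted by `l`. -/
theorem isWeightedJoin_generate {q : 𝒬} (l : PSh Y.toTypedSet q) :
    Y.closedCat.IsWeightedJoin (representable Y) l (generate Y l) := by
  refine ⟨rfl, fun p (e' : ClosedPSh Y) hp v => le_homAs_iff.trans ?_⟩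
  refine (iff_of_eq (congrArg (v ≤ PSh.hom · (e'.as hp)) (generate Y l).as_rfl)).trans ?_
  refine (Y.le_hom_cl_iff (e'.cl_as_le hp)).trans (PSh.le_hom.trans (forall_congr' fun y => ?_))
  refine Iff.trans ?_ (le_homAs_iff (e := representable Y y) (h := rfl)).symm
  rw [as_rfl]
  exact (representable_hom y (e'.cl_as_le hp) _).symm

end ClosedPSh

/-- The separated complete category of closed presheaves of a closure space. -/
def ClosureSpace.closedSup (X : ClosureSpace 𝒬) : QSup 𝒬 where
  toQCat := X.closedCat
  separated := by
    rintro ⟨q, μ, h⟩ ⟨q', μ', h'⟩ hle hge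
    obtain rfl : q = q' := hle.1
    obtain rfl : μ = μ' :=
      le_antisymm ((ClosedPSh.mk_le_mk h h').1 hle) ((ClosedPSh.mk_le_mk h' h).1 hge)
    rfl
  complete q W _ := by
    -- The pointwise `W`-weighted join is the supremum among all presheaves; the reflection `cl`
    -- turns it into the supremum among closed ones.
    let μ : PSh X.toTypedSet q := fun x => ⨆ e : ClosedPSh X, e.psh x ≫ W e
    refine ⟨ClosedPSh.generate X μ,
      X.closedCat.isSup_iff.2 ⟨rfl, fun (e : ClosedPSh X) v =>
        (ClosedPSh.le_homAs_rfl_iff (ClosedPSh.generate X μ) e).trans ?_⟩⟩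
    refine (X.le_hom_cl_iff e.cl_le).trans ?_
    simp only [μ, PSh.le_hom, iSup_comp, iSup_le_iff, Category.assoc]
    exact forall_comm

/-! ### Closed continuous relations versus sup-preserving functors of closed presheaves. -/

namespace ContRel

variable {X Y Z : ClosureSpace 𝒬}

/-- Continuity moves the inner closure outside, where idempotence absorbs it. Hence the intermediate
closure in a composite of two `closedMap`s is harmless. -/
theorem cl_pull_cl (ζ : ContRel X Y) {q : 𝒬} (l : PSh Y.toTypedSet q) :
    X.cl (ζ.1.pull (Y.cl l)) = X.cl (ζ.1.pull l) :=
  le_antisymm ((X.cl_mono (ζ.2 q l)).trans (X.cl_cl_le _))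
    (X.cl_mono (QRel.pull_mono le_rfl (Y.le_cl l)))

/-- Composites and identities in the quotient carry an extra `closure`; by this equality it does not
affect `closedMap`. -/
theorem cl_pull_closure (ζ : QRel X.toTypedSet Y.toTypedSet) {q : 𝒬} (l : PSh Y.toTypedSet q) :
    X.cl (ζ.closure.pull l) = X.cl (ζ.pull l) :=
  le_antisymm ((X.cl_mono (ClosureSpace.pull_closure_le ζ l)).trans (X.cl_cl_le _))
    (X.cl_mono (QRel.pull_mono (ClosureSpace.le_closure ζ) le_rfl))

/-- The right adjoint of `ζ^* : PY → PX`. -/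
def push (ζ : ContRel X Y) {q : 𝒬} (μ : PSh X.toTypedSet q) : PSh Y.toTypedSet q :=
  fun y => sSup {u | ∀ x, ζ.1 x y ≫ u ≤ μ x}

theorem le_push_iff (ζ : ContRel X Y) {q : 𝒬} {μ : PSh X.toTypedSet q} {y : Y.carrier}
    {u : Y.type y ⟶ q} : u ≤ ζ.push μ y ↔ ∀ x, ζ.1 x y ≫ u ≤ μ x := by
  refine ⟨fun h x => (comp_mono le_rfl h).trans ?_, fun h => le_sSup h⟩
  rw [push, Quantaloid.comp_sSup]
  exact iSup₂_le fun u hu => hu x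

theorem pull_le_iff (ζ : ContRel X Y) {q : 𝒬} {μ : PSh X.toTypedSet q} {l : PSh Y.toTypedSet q} :
    ζ.1.pull l ≤ μ ↔ l ≤ ζ.push μ :=
  ⟨fun h y => ζ.le_push_iff.2 fun x => (le_iSup (fun y => ζ.1 x y ≫ l y) y).trans (h x),
    fun h x => iSup_le fun y => ζ.le_push_iff.1 (h y) x⟩

/-- After transposing, continuity bounds `ζ^* (cl (push μ))` by the closure of `ζ^* (push μ)`, which
lies below `μ` by the counit and closedness of `μ`. So the right adjoint restricts to closed
presheaves. -/
theorem cl_push_le (ζ : ContRel X Y) {q : 𝒬} {μ : PSh X.toTypedSet q} (h : X.cl μ ≤ μ) :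
    Y.cl (ζ.push μ) ≤ ζ.push μ := by
  rw [← pull_le_iff]
  exact (ζ.2 q _).trans ((X.cl_mono (ζ.pull_le_iff.2 le_rfl)).trans h)

/-- Removes both the closure and the join in `pull`, leaving a condition on pairs `(x, y)`. In this
form it matches the definition of `push` and the universal property of weighted joins. -/
theorem le_hom_cl_pull_iff (ζ : QRel X.toTypedSet Y.toTypedSet) {q q' : 𝒬}
    {l : PSh Y.toTypedSet q} {μ : PSh X.toTypedSet q'} (h : X.cl μ ≤ μ) {v : q ⟶ q'} :
    v ≤ (X.cl (ζ.pull l)).hom μ ↔ ∀ y x, ζ x y ≫ l y ≫ v ≤ μ x := by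
  rw [X.le_hom_cl_iff h, PSh.le_hom]
  simp only [QRel.pull, iSup_comp, iSup_le_iff, Category.assoc]
  exact forall_comm

/-- The sup-preserving functor `l ↦ cl (l ∘ ζ)` between closed presheaves. -/
def closedMap (ζ : ContRel X Y) : SupMap Y.closedSup X.closedSup :=
  ⟨{ toFun := fun e : ClosedPSh Y => ClosedPSh.generate X (ζ.1.pull e.psh)
     type_eq := fun _ => rfl
     hom_le := fun (e e' : ClosedPSh Y) => by
      refine (ClosedPSh.le_homAs_rfl_iff (ClosedPSh.generate X (ζ.1.pull e.psh))
        (ClosedPSh.generate X (ζ.1.pull e'.psh))).2 ?_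
      refine (le_hom_cl_pull_iff ζ.1 (X.cl_cl_le _)).2 fun y x => ?_
      refine le_trans ?_ (X.le_cl _ x)
      exact le_iSup_of_le (f := fun y => ζ.1 x y ≫ e'.psh y) y
        (comp_mono le_rfl (PSh.le_hom.1 le_rfl y)) },
    QFunctor.isSupPreserving_of_adjoint _
      -- The right adjoint is `push`, restricted to closed presheaves.
      (fun e : ClosedPSh X => (⟨e.type, ζ.push e.psh, ζ.cl_push_le e.cl_le⟩ : ClosedPSh Y))
      (fun _ => rfl) fun (e : ClosedPSh Y) (e' : ClosedPSh X) => by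
        let e₁ : ClosedPSh X := ClosedPSh.generate X (ζ.1.pull e.psh)
        let e₂ : ClosedPSh Y := ⟨e'.type, ζ.push e'.psh, ζ.cl_push_le e'.cl_le⟩
        refine eq_of_forall_le_iff fun v : e.type ⟶ e'.type =>
          (ClosedPSh.le_homAs_rfl_iff e₁ e').trans ?_
        refine Iff.trans ?_ (ClosedPSh.le_homAs_rfl_iff e e₂).symm
        refine (le_hom_cl_pull_iff ζ.1 e'.cl_le).trans ?_
        refine Iff.trans ?_ (PSh.le_hom (μ := e.psh) (μ' := e₂.psh)).symm
        exact forall_congr' fun y => ζ.le_push_iff.symm⟩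

/-- Pulling back the representable of `y` along a relation yields its column at `y`, so testing on
closed representables compares columns. The converse is `pull_closure_le`. -/
theorem closedMap_le_iff (ζ ζ' : ContRel X Y) :
    ζ.closedMap ≤ ζ'.closedMap ↔ ζ.1 ≤ QRel.closure ζ'.1 := by
  have h : ∀ e : ClosedPSh Y, X.closedSup.le (ζ.closedMap.1.toFun e) (ζ'.closedMap.1.toFun e) ↔
      ζ.1.pull e.psh ≤ X.cl (ζ'.1.pull e.psh) := fun e =>
    (ClosedPSh.mk_le_mk _ _).trans (X.cl_le_iff (X.cl_cl_le _))
  refine ⟨fun H x y => ?_, fun H e => (h e).2 ?_⟩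
  · have h1 := (h (ClosedPSh.representable Y y)).1 (H _)
    rw [← X.cl_le_iff (X.cl_cl_le _)] at h1
    -- Continuity of both relations drops the closure around the representable.
    replace h1 := (ζ.cl_pull_cl _).ge.trans (h1.trans (ζ'.cl_pull_cl _).le)
    have h2 : ∀ θ : QRel X.toTypedSet Y.toTypedSet,
        θ.pull (fun y' => QRel.id Y.toTypedSet y' y) = fun x => θ x y := fun θ =>
      funext fun x => congrFun (congrFun (QRel.comp_id θ) x) y
    replace h1 := (congrArg X.cl (h2 ζ.1)).ge.trans (h1.trans (congrArg X.cl (h2 ζ'.1)).le)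
    exact (X.le_cl (fun x => ζ.1 x y) x).trans (h1 x)
  · exact (QRel.pull_mono H le_rfl).trans (ClosureSpace.pull_closure_le _ _)

/-- Every sup-preserving functor between closed presheaves comes from a closed continuous
relation. -/
theorem exists_closedMap_eq (f : SupMap Y.closedSup X.closedSup) :
    ∃ ζ : ContRel X Y, QRel.closure ζ.1 ≤ ζ.1 ∧ ζ.closedMap = f := by
  have ht : ∀ y, ClosedPSh.type (f.1.toFun (ClosedPSh.representable Y y)) = Y.type y :=
    fun y => f.1.type_eq _
  -- The column of `ζ` at `y` is the value of `f` on the closed representable of `y`, transported to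
  -- type `|y|`.
  let ζ : QRel X.toTypedSet Y.toTypedSet := fun x y => ClosedPSh.as _ (ht y) x
  -- Both sides are the join of these columns weighted by `l`: on the left because `f` preserves
  -- weighted joins, on the right by construction.
  have hζ : ∀ {q : 𝒬} (l : PSh Y.toTypedSet q),
      f.1.toFun (ClosedPSh.generate Y l) = ClosedPSh.generate X (ζ.pull l) := by
    intro q l
    refine X.closedSup.separated.eq_of_forall_le_homAs_iff (q := q) (f.1.type_eq _) rfl
      fun e v => ?_
    refine (f.2.le_homAs_iff (ClosedPSh.isWeightedJoin_generate l) e v).trans ?_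
    refine Iff.trans ?_ ((ClosedPSh.le_homAs_rfl_iff (ClosedPSh.generate X (ζ.pull l)) e).trans
      (le_hom_cl_pull_iff ζ (ClosedPSh.cl_le e))).symm
    refine forall_congr' fun y => ClosedPSh.le_homAs_iff.trans ?_
    refine (iff_of_eq (congrArg (_ ≤ PSh.hom _ ·) (ClosedPSh.as_rfl e))).trans ?_
    exact PSh.le_hom
  -- `l` and `Y.cl l` generate the same closed presheaf, so `f` cannot tell them apart; continuity
  -- of `ζ` follows.
  have hcl : ∀ {q : 𝒬} (l : PSh Y.toTypedSet q), X.cl (ζ.pull (Y.cl l)) = X.cl (ζ.pull l) := by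
    intro q l
    rw [← ClosedPSh.generate_inj, ← hζ, ← hζ]
    exact congrArg f.1.toFun (ClosedPSh.generate Y l).generate_psh
  refine ⟨⟨ζ, fun q l => (X.le_cl _).trans (hcl l).le⟩, fun x y => ClosedPSh.cl_as_le _ _ x,
    Subtype.ext (QFunctor.ext (funext fun e => ?_))⟩
  exact (hζ _).symm.trans (congrArg f.1.toFun e.generate_psh)

theorem closedMap_closure_comp (ζ : ContRel X Y) (η : ContRel Y Z) (θ : ContRel X Z)
    (h : θ.1 = QRel.closure (ζ.1.comp η.1)) : θ.closedMap = η.closedMap.comp ζ.closedMap := by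
  refine Subtype.ext (QFunctor.ext (funext fun e => ?_))
  change ClosedPSh.generate X (θ.1.pull e.psh) =
    ClosedPSh.generate X (ζ.1.pull (Y.cl (η.1.pull e.psh)))
  rw [ClosedPSh.generate_inj, cl_pull_cl, h, cl_pull_closure, QRel.pull_comp]

theorem closedMap_closure_id (θ : ContRel X X) (h : θ.1 = QRel.closure (QRel.id X.toTypedSet)) :
    θ.closedMap = SupMap.id X.closedSup := by
  refine Subtype.ext (QFunctor.ext (funext fun e => ?_))
  change ClosedPSh.generate X (θ.1.pull e.psh) = e
  refine Eq.trans ?_ e.generate_psh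
  rw [ClosedPSh.generate_inj, h, cl_pull_closure, QRel.pull_id]

end ContRel

/-! ### The functor of closed presheaves -/

variable (𝒬) in
/-- The contravariant functor sending a closure space to its category of closed presheaves. -/
noncomputable def closedPShFunctor : (ClsRelCl 𝒬)ᵒᵖ ⥤ QSup 𝒬 where
  obj X := X.unop.obj.closedSup
  map f := ContRel.closedMap f.unop.1
  map_id _ := ContRel.closedMap_closure_id _ rfl
  map_comp f g := ContRel.closedMap_closure_comp g.unop.1 f.unop.1 _ rfl

/-- Arrows of the quotient are closed, so the closure in `closedMap_le_iff` disappears. Faithfulness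
and preservation of joins both come from this. -/
theorem closedPShFunctor_map_le_iff {X Y : ClsRelCl 𝒬} (f g : X ⟶ Y) :
    (closedPShFunctor 𝒬).map f.op ≤ (closedPShFunctor 𝒬).map g.op ↔ f ≤ g := by
  refine (ContRel.closedMap_le_iff f.1 g.1).trans ?_
  have h : QRel.closure g.1.1 = g.1.1 := congrArg Subtype.val g.2.closure_eq
  rw [h]
  exact Iff.rfl

instance : (closedPShFunctor 𝒬).Faithful where
  map_injective {_ _ f g} h := Quiver.Hom.unop_inj <| le_antisymm
    ((closedPShFunctor_map_le_iff f.unop g.unop).1 h.le)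
    ((closedPShFunctor_map_le_iff g.unop f.unop).1 h.ge)

instance : (closedPShFunctor 𝒬).Full where
  map_surjective {X Y} f := by
    obtain ⟨ζ, h, rfl⟩ := ContRel.exists_closedMap_eq (X := Y.unop.obj) (Y := X.unop.obj) f
    let ζ' : Y.unop ⟶ X.unop := ⟨ζ, ((closureNucleus 𝒬).cl _ _).isClosed_iff_closure_le.2 h⟩
    exact ⟨ζ'.op, rfl⟩

/-- A surjective order embedding preserves joins: by fullness the join of the images is the image of
some `g`, and reflecting the order makes `g` an upper bound of `S`. -/
theorem closedPShFunctor_map_sSup {X Y : ClsRelCl 𝒬} (S : Set (X ⟶ Y)) :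
    (closedPShFunctor 𝒬).map (sSup S).op = ⨆ f ∈ S, (closedPShFunctor 𝒬).map f.op := by
  refine le_antisymm ?_ (iSup₂_le fun f hf => (closedPShFunctor_map_le_iff _ _).2 (le_sSup hf))
  obtain ⟨g, hg⟩ := (closedPShFunctor 𝒬).map_surjective (⨆ f ∈ S, (closedPShFunctor 𝒬).map f.op)
  rw [← hg]
  refine (closedPShFunctor_map_le_iff _ g.unop).2 (sSup_le fun f hf => ?_)
  rw [← closedPShFunctor_map_le_iff, Quiver.Hom.op_unop, hg]
  exact le_iSup₂_of_le (f := fun f (_ : f ∈ S) => (closedPShFunctor 𝒬).map f.op) f hf le_rfl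

/-! ### Complete categories as closure spaces -/

namespace QSup

/-- The supremum in `X` of a presheaf on the set of elements of `X`. -/
noncomputable def sup (X : QSup 𝒬) {q : 𝒬} (μ : PSh X.toTypedSet q) : X.carrier :=
  (X.complete.exists_isWeightedJoin (fun x => x) μ).choose

theorem isWeightedJoin_sup (X : QSup 𝒬) {q : 𝒬} (μ : PSh X.toTypedSet q) :
    X.IsWeightedJoin (fun x => x) μ (X.sup μ) :=
  (X.complete.exists_isWeightedJoin (fun x => x) μ).choose_spec

theorem type_sup (X : QSup 𝒬) {q : 𝒬} (μ : PSh X.toTypedSet q) : X.type (X.sup μ) = q :=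
  (X.isWeightedJoin_sup μ).1

theorem le_homAs_sup_iff (X : QSup 𝒬) {p q : 𝒬} {μ : PSh X.toTypedSet q} {y : X.carrier}
    {hy : X.type y = p} {v : q ⟶ p} :
    v ≤ X.homAs (X.sup μ) y (X.type_sup μ) hy ↔ ∀ x, μ x ≫ v ≤ X.homAs x y rfl hy :=
  (X.isWeightedJoin_sup μ).2 p y hy v

theorem le_homAs_of_sup (X : QSup 𝒬) {q : 𝒬} (μ : PSh X.toTypedSet q) (x : X.carrier) :
    μ x ≤ X.homAs x (X.sup μ) rfl (X.type_sup μ) := by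
  have := X.le_homAs_sup_iff.1 (X.id_le_homAs (X.sup μ) (X.type_sup μ)) x
  rwa [Category.comp_id] at this

/-- The closure space on the elements of `X` in which the closure of `μ` is represented by the
supremum of `μ`. -/
noncomputable abbrev closureSpace (X : QSup 𝒬) : ClosureSpace 𝒬 where
  toTypedSet := X.toTypedSet
  cl μ x := X.homAs x (X.sup μ) rfl (X.type_sup μ)
  hom_le {q q'} μ μ' := by
    refine PSh.le_hom.2 fun x => le_trans (comp_mono le_rfl ?_)
      (X.homAs_comp rfl (X.type_sup μ) (X.type_sup μ'))
    exact X.le_homAs_sup_iff.2 fun x => (PSh.le_hom.1 le_rfl x).trans (X.le_homAs_of_sup μ' x)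
  le_cl μ := X.le_homAs_of_sup μ
  cl_cl_le {q} μ x := by
    -- The presheaf `X(-, sup μ)` is bounded by `sup μ`, hence so is its supremum.
    have h : 𝟙 q ≤ X.homAs (X.sup fun x => X.homAs x (X.sup μ) rfl (X.type_sup μ)) (X.sup μ)
        (X.type_sup _) (X.type_sup μ) :=
      X.le_homAs_sup_iff.2 fun x => (Category.comp_id _).le
    have := (comp_mono le_rfl h).trans (X.homAs_comp (x := x) rfl (X.type_sup _) (X.type_sup μ))
    rwa [Category.comp_id] at this

theorem cl_hom_le (X : QSup 𝒬) (x : X.carrier) :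
    X.closureSpace.cl (fun y => X.hom y x) ≤ fun y => X.hom y x := by
  intro y
  have h : 𝟙 (X.type x) ≤ X.homAs (X.sup fun y => X.hom y x) x (X.type_sup _) rfl :=
    X.le_homAs_sup_iff.2 fun y => by rw [Category.comp_id, X.homAs_rfl]
  have := (comp_mono le_rfl h).trans (X.homAs_comp (x := y) rfl (X.type_sup _) rfl)
  rwa [Category.comp_id, X.homAs_rfl] at this

/-- The closed presheaf `X(-, x)`. -/
abbrev yoneda (X : QSup 𝒬) (x : X.carrier) : ClosedPSh X.closureSpace :=
  ⟨X.type x, fun y => X.hom y x, X.cl_hom_le x⟩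

/-- Closed presheaves are representable, by their suprema; this is the core of `closedSupIso`. -/
theorem psh_eq_homAs_sup (X : QSup 𝒬) (e : ClosedPSh X.closureSpace) (x : X.carrier) :
    e.psh x = X.homAs x (X.sup e.psh) rfl (X.type_sup e.psh) :=
  le_antisymm (X.le_homAs_of_sup e.psh x) (e.cl_le x)

theorem sup_yoneda (X : QSup 𝒬) (x : X.carrier) : X.sup (X.yoneda x).psh = x := by
  refine X.separated.eq_of_forall_le_homAs_iff (X.type_sup _) rfl
    fun y (v : X.type x ⟶ X.type y) => ?_
  refine X.le_homAs_sup_iff.trans ?_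
  simp only [X.homAs_rfl]
  refine ⟨fun H => ?_, fun H z => (comp_mono le_rfl H).trans (X.comp_le _ _ _)⟩
  have := (comp_mono (X.id_le x) le_rfl).trans (H x)
  rwa [Category.id_comp] at this

theorem yoneda_sup (X : QSup 𝒬) (e : ClosedPSh X.closureSpace) : X.yoneda (X.sup e.psh) = e := by
  -- The types of the two presheaves agree only propositionally, so they are compared after
  -- transport, and separatedness gives the equality.
  have h : (X.yoneda (X.sup e.psh)).as (X.type_sup e.psh) = e.as rfl := by
    rw [ClosedPSh.as_rfl]
    funext x
    rw [X.psh_eq_homAs_sup, QCat.homAs, eqToHom_refl, Category.id_comp]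
    rfl
  exact X.closureSpace.closedSup.separated _ _
    ((ClosedPSh.le_iff _ e (X.type_sup e.psh) rfl).2 h.le)
    ((ClosedPSh.le_iff e _ rfl (X.type_sup e.psh)).2 h.ge)

/-- The Yoneda lemma, as `e` is represented by its supremum. It makes `sup` right adjoint to
`yoneda`, so `yonedaMap` preserves suprema. -/
theorem le_yoneda_hom_iff (X : QSup 𝒬) (x : X.carrier) (e : ClosedPSh X.closureSpace)
    (v : X.type x ⟶ e.type) :
    v ≤ (X.yoneda x).psh.hom e.psh ↔ v ≤ X.homAs x (X.sup e.psh) rfl (X.type_sup e.psh) := by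
  rw [PSh.le_hom]
  simp only [X.psh_eq_homAs_sup]
  refine ⟨fun H => ?_, fun H y => ?_⟩
  · have := (comp_mono (X.id_le x) le_rfl).trans (H x)
    rwa [Category.id_comp] at this
  · refine (comp_mono (X.homAs_rfl y x).ge H).trans ?_
    exact X.homAs_comp _ _ _

/-- The sup-preserving functor `x ↦ X(-, x)` into the closed presheaves. -/
noncomputable def yonedaMap (X : QSup 𝒬) : SupMap X X.closureSpace.closedSup :=
  ⟨{ toFun := X.yoneda
     type_eq := fun _ => rfl
     hom_le := fun x x' =>
       (ClosedPSh.le_homAs_rfl_iff (X.yoneda x) (X.yoneda x')).2 <|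
         PSh.le_hom.2 fun y => X.comp_le y x x' },
    QFunctor.isSupPreserving_of_adjoint _ (fun e : ClosedPSh X.closureSpace => X.sup e.psh)
      (fun e : ClosedPSh X.closureSpace => X.type_sup e.psh)
      fun x (e : ClosedPSh X.closureSpace) => eq_of_forall_le_iff fun v =>
        (ClosedPSh.le_homAs_rfl_iff (X.yoneda x) e).trans (X.le_yoneda_hom_iff x e v)⟩

/-- The adjunction in the other direction, with `sup` on the left; it gives sup-preservation of
`supMap`. -/
theorem le_homAs_sup_iff_le_hom_yoneda (X : QSup 𝒬) (x : X.carrier) {q : 𝒬}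
    (μ : PSh X.toTypedSet q) (v : q ⟶ X.type x) :
    v ≤ X.homAs (X.sup μ) x (X.type_sup μ) rfl ↔
      v ≤ PSh.hom (X := X.toTypedSet) μ (X.yoneda x).psh := by
  rw [X.le_homAs_sup_iff, PSh.le_hom]
  simp only [X.homAs_rfl]

/-- The sup-preserving functor sending a closed presheaf to its supremum. -/
noncomputable def supMap (X : QSup 𝒬) : SupMap X.closureSpace.closedSup X :=
  ⟨{ toFun := fun e : ClosedPSh X.closureSpace => X.sup e.psh
     type_eq := fun e : ClosedPSh X.closureSpace => X.type_sup e.psh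
     hom_le := fun (_ e' : ClosedPSh X.closureSpace) => X.le_homAs_sup_iff.2 fun x =>
       (PSh.le_hom.1 le_rfl x).trans (X.psh_eq_homAs_sup e' x).le },
    QFunctor.isSupPreserving_of_adjoint _ X.yoneda (fun _ => rfl)
      fun (e : ClosedPSh X.closureSpace) x => eq_of_forall_le_iff fun v =>
        (X.le_homAs_sup_iff_le_hom_yoneda x e.psh v).trans
          (ClosedPSh.le_homAs_rfl_iff e (X.yoneda x)).symm⟩

/-- A separated complete category is isomorphic to the category of closed presheaves of its closure
space. -/
noncomputable def closedSupIso (X : QSup 𝒬) : X.closureSpace.closedSup ≅ X where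
  hom := X.supMap
  inv := X.yonedaMap
  hom_inv_id := Subtype.ext <| QFunctor.ext <| funext fun e => X.yoneda_sup e
  inv_hom_id := Subtype.ext <| QFunctor.ext <| funext fun x => X.sup_yoneda x

end QSup

/-! ### The dual equivalence. -/

instance : (closedPShFunctor 𝒬).EssSurj where
  mem_essImage X := ⟨.op ⟨X.closureSpace⟩, ⟨X.closedSupIso⟩⟩

theorem dual_clsRelCl_qSup : DuallyEquivalent (ClsRelCl 𝒬) (QSup 𝒬) := by
  have : (closedPShFunctor 𝒬).IsEquivalence := {}
  let e := (closedPShFunctor 𝒬).asEquivalence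
  refine ⟨e, fun X Y S => closedPShFunctor_map_sSup S, fun A B S => ?_⟩
  -- For the inverse, joins are compared after applying the faithful, join-preserving functor.
  apply Quiver.Hom.op_inj
  apply e.functor.map_injective
  refine Eq.trans ?_ (Eq.symm (Eq.trans (congrArg (fun g => e.functor.map (Quiver.Hom.op g))
    (sSup_image (s := S) (f := fun g => (e.inverse.map g).unop)).symm)
    (closedPShFunctor_map_sSup _)))
  rw [iSup_image]
  simp only [Quiver.Hom.op_unop]
  -- Applying both functors to `g` conjugates it by the counit, and composition preserves joins.
  have h : ∀ g : A ⟶ B, (closedPShFunctor 𝒬).map (e.inverse.map g) =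
    e.counit.app A ≫ g ≫ e.counitInv.app B := fun g => e.fun_inv_map A B g
  refine (h _).trans ?_
  simp only [h, Quantaloid.sSup_comp, comp_iSup]
  rfl

end

end FuzzyClosure

theorem mainTheorem12 (Q : Type u) [Monoid Q] [CompleteLattice Q] [IsQuantale Q]
    [FuzzyClosure.IsDivisibleQuantale Q] :
    FuzzyClosure.DuallyEquivalent (FuzzyClosure.FuzzyClsRelCl Q) (FuzzyClosure.FuzzySup Q) :=
  FuzzyClosure.dual_clsRelCl_qSup
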